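/- \textbf{Theorem (Persistence--Spanier correspondence).} Let $X$ be a geodesic metric space (any two points $x,y$ are the endpoints of an isometrically embedded copy of $[0,d(x,y)]$), let $\bullet\in X$ be a basepoint and let $G$ be an Abelian group. For $r>0$ let $\mathrm{Rips}(X,r)$ be the (geometric realization of the) simplicial complex with vertex set $X$ whose simplices are the nonempty finite subsets of $X$ of diameter $<r$; for $p<q$ let $i_{p,q}\colon \mathrm{Rips}(X,p)\to\mathrm{Rips}(X,q)$ be the inclusion. Let $\mathcal S(X,r,\pi_1)\le\pi_1(X,\bullet)$ be the subgroup generated by the classes of all loops $\alpha*\beta*\alpha^-$, where $\alpha$ is a path starting at $\bullet$ and $\beta$ is a loop based at the endpoint of $\alpha$ and contained in a closed ball of some radius $d<r$; this subgroup is normal. Let $\mathcal S(X,r,G)\le H_1(X;G)$ be the subgroup generated by the classes $g\cdot[\beta]$, where $g\in G$ and $\beta$ is a loop contained in a closed ball of some radius $d<r$. An $r$-sample of a loop $\alpha\colon[0,1]\to X$ is a choice of $0\le t_0<t_1<\dots<t_m\le 1$ such that $\mathrm{Diam}\,\alpha([t_i,t_{i+1}])<r$ for $0\le i<m$ and $\mathrm{Diam}\,\alpha([0,t_0]\cup[t_m,1])<r$,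 together with the induced edge loop in $\mathrm{Rips}(X,r)$ through the vertices $\alpha(t_0),\dots,\alpha(t_m),\alpha(t_0)$. For loops based at $\bullet$ one requires $t_0=0$. \begin{enumerate} \item There are group isomorphisms $$\pi_1(X,\bullet)/\mathcal S(X,3r/2,\pi_1)\;\cong\;\pi_1(\mathrm{Rips}(X,r),\bullet)\qquad (r>0)$$ which send the class of each loop $\alpha$ based at $\bullet$ to the class of each of its $r$-samples with $t_0=0$, and which, for all $0<p<q$, commute with the homomorphism induced by $i_{p,q}$ and the quotient map $\pi_1(X,\bullet)/\mathcal S(X,3p/2,\pi_1)\to\pi_1(X,\bullet)/\mathcal S(X,3q/2,\pi_1)$. \item There are group isomorphisms $$H_1(X;G)/\mathcal S(X,3r/2,G)\;\cong\;H_1(\mathrm{Rips}(X,r);G)\qquad (r>0)$$ which, for each loop $\alpha$ in $X$ and each $g\in G$, send the class of $g\cdot[\alpha]$ to $g\cdot[L]$ for each $r$-sample $L$ of $\alpha$, and which, for all $0<p<q$, commute with the homomorphism induced by $i_{p,q}$ and the quotient map $H_1(X;G)/\mathcal S(X,3p/2,G)\to H_1(X;G)/\mathcal S(X,3q/2,G)$.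 \end{enumerate} -/

import Mathlib

open CategoryTheory

universe u v

noncomputable section

namespace RipsSpanier

/-- A metric space is geodesic if any two points `x`, `y` are joined by an isometrically embedded
copy of the interval `[0, d(x, y)]`. -/
def IsGeodesicSpace (X : Type u) [MetricSpace X] : Prop :=
  ∀ x y : X, ∃ γ : Set.Icc (0 : ℝ) (dist x y) → X, Isometry γ ∧
    γ ⟨0, Set.left_mem_Icc.mpr dist_nonneg⟩ = x ∧
    γ ⟨dist x y, Set.right_mem_Icc.mpr dist_nonneg⟩ = y

/-! ### Geometric realization of an abstract simplicial complex -/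

section Realization

variable {V : Type u}

/-- The underlying set of the geometric realization of `K`: barycentric coordinates, that is,
nonnegative weights on the vertices which vanish outside some face and have total weight `1`. -/
def Realization (K : AbstractSimplicialComplex V) : Type u :=
  {w : V → ℝ // (∀ v, 0 ≤ w v) ∧ ∃ s ∈ K.faces, (∀ v, v ∉ s → w v = 0) ∧ ∑ v ∈ s, w v = 1}

namespace Realization

variable {K L : AbstractSimplicialComplex V}

open Classical in
/-- The inclusion of the closed simplex spanned by the face `s`. -/
def cell (s : K.faces) (w : stdSimplex ℝ (s : Finset V)) : Realization K :=
  ⟨fun v => if h : v ∈ (s : Finset V) then w.1 ⟨v, h⟩ else 0, by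
    refine ⟨fun v => ?_, s.1, s.2, fun v hv => dif_neg hv, ?_⟩
    · dsimp only
      split_ifs with h
      · exact w.2.1 _
      · exact le_rfl
    · rw [← Finset.sum_coe_sort, ← w.2.2]
      exact Finset.sum_congr rfl fun v _ => dif_pos v.2⟩

/-- The weak topology: a set is open if and only if its trace on every closed simplex is open. -/
instance : TopologicalSpace (Realization K) :=
  ⨆ s : K.faces, TopologicalSpace.coinduced (cell s) inferInstance

theorem continuous_cell (s : K.faces) : Continuous (cell s) :=
  continuous_iff_coinduced_le.mpr (le_iSup (fun s : K.faces =>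
    TopologicalSpace.coinduced (cell s) inferInstance) s)

/-- The continuous inclusion of realizations induced by an inclusion of simplicial complexes. -/
def incl (h : K ≤ L) : C(Realization K, Realization L) where
  toFun w := ⟨w.1, w.2.1, w.2.2.imp fun _ hs => ⟨h hs.1, hs.2⟩⟩
  continuous_toFun := by
    refine continuous_iSup_dom.mpr fun s => continuous_coinduced_dom.mpr ?_
    exact continuous_cell (K := L) ⟨s.1, h s.2⟩

open Classical in
/-- The point of the realization given by a vertex. -/
def vertex (K : AbstractSimplicialComplex V) (x : V) : Realization K :=
  ⟨fun v => if v = x then 1 else 0, fun v => by dsimp only; split_ifs <;> norm_num,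
    {x}, K.singleton_mem x, fun v hv => if_neg (by simpa using hv), by simp⟩

theorem incl_vertex (h : K ≤ L) (x : V) : incl h (vertex K x) = vertex L x := rfl

open Classical in
/-- The straight path `t ↦ (1 - t) x + t y` along the edge `{x, y}`
(a constant path if `x = y`). -/
def edge (K : AbstractSimplicialComplex V) {x y : V} (h : ({x, y} : Finset V) ∈ K.faces) :
    Path (vertex K x) (vertex K y) where
  toFun t := cell ⟨{x, y}, h⟩
    ⟨fun v => (1 - (t : ℝ)) * (if v.1 = x then 1 else 0) + t * (if v.1 = y then 1 else 0), by
      refine ⟨fun v => ?_, ?_⟩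
      · have h0 := t.2.1
        have h1 : 0 ≤ 1 - (t : ℝ) := sub_nonneg.mpr t.2.2
        dsimp only
        split_ifs <;> simp <;> linarith
      · rw [Finset.sum_coe_sort ({x, y} : Finset V) (fun v =>
          (1 - (t : ℝ)) * (if v = x then 1 else 0) + t * (if v = y then 1 else 0)),
          Finset.sum_add_distrib, ← Finset.mul_sum, ← Finset.mul_sum]
        simp⟩
  continuous_toFun := by
    refine (continuous_cell _).comp (Continuous.subtype_mk (continuous_pi fun v => ?_) _)
    fun_prop
  source' := by
    apply Subtype.ext
    funext v
    by_cases hx : v = x <;> by_cases hy : v = y <;> simp [cell, vertex, hx, hy]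
  target' := by
    apply Subtype.ext
    funext v
    by_cases hx : v = x <;> by_cases hy : v = y <;> simp [cell, vertex, hx, hy]

open Classical in
/-- The edge path in the realization through the vertices `x 0, x 1, …, x n`. -/
def edgePath (K : AbstractSimplicialComplex V) : ∀ {n : ℕ} (x : Fin (n + 1) → V)
    (_ : ∀ i : Fin n, ({x i.castSucc, x i.succ} : Finset V) ∈ K.faces),
    Path (vertex K (x 0)) (vertex K (x (Fin.last n)))
  | 0, x, _ => Path.refl (vertex K (x 0))
  | _ + 1, x, h => (edgePath K (fun i => x i.castSucc) fun i => h i.castSucc).trans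
      (edge K (h (Fin.last _)))

open Classical in
/-- The edge loop in the realization through the vertices `x 0, x 1, …, x n, x 0`. -/
def edgeLoop (K : AbstractSimplicialComplex V) {n : ℕ} (x : Fin (n + 1) → V)
    (h : ∀ i : Fin n, ({x i.castSucc, x i.succ} : Finset V) ∈ K.faces)
    (h' : ({x (Fin.last n), x 0} : Finset V) ∈ K.faces) :
    Path (vertex K (x 0)) (vertex K (x 0)) :=
  (edgePath K x h).trans (edge K h')

end Realization

end Realization

/-! ### Open Rips complexes and samples of loops -/

section Rips

variable (X : Type u) [MetricSpace X]

/-- The open Rips complex: the faces are the nonempty finite sets of diameter `< r`. -/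
def rips (r : ℝ) (hr : 0 < r) : AbstractSimplicialComplex X where
  faces := {s | s.Nonempty ∧ Metric.diam (s : Set X) < r}
  isRelLowerSet_faces := fun _ hs => ⟨hs.1, fun _ hts ht =>
    ⟨ht, (Metric.diam_mono (Finset.coe_subset.mpr hts)
      (Finset.finite_toSet _).isBounded).trans_lt hs.2⟩⟩
  singleton_mem x := by simpa using hr

/-- The geometric realization of the open Rips complex. -/
abbrev Rips (r : ℝ) (hr : 0 < r) : Type u := Realization (rips X r hr)

theorem rips_mono {p q : ℝ} (hp : 0 < p) (hpq : p < q) :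
    rips X p hp ≤ rips X q (hp.trans hpq) :=
  fun _ hs => ⟨hs.1, hs.2.trans hpq⟩

/-- The bonding map `i_{p,q} : Rips(X, p) → Rips(X, q)`. -/
def bonding {p q : ℝ} (hp : 0 < p) (hpq : p < q) : C(Rips X p hp, Rips X q (hp.trans hpq)) :=
  Realization.incl (rips_mono X hp hpq)

variable {X}

open Classical in
theorem pair_mem_rips {r : ℝ} (hr : 0 < r) {S : Set X} (hS : Bornology.IsBounded S)
    (hd : Metric.diam S < r) {x y : X} (hx : x ∈ S) (hy : y ∈ S) :
    ({x, y} : Finset X) ∈ (rips X r hr).faces :=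
  ⟨Finset.insert_nonempty _ _, by
    simpa [Metric.diam_pair] using (Metric.dist_le_diam_of_mem hS hx hy).trans_lt hd⟩

/-- An `r`-sample of a loop `α`: parameters `t 0 < t 1 < ⋯ < t m` cutting the (cyclic) domain into
arcs whose images have diameter `< r`. -/
structure Sample {x : X} (α : Path x x) (r : ℝ) where
  m : ℕ
  t : Fin (m + 1) → unitInterval
  strictMono : StrictMono t
  diam_lt : ∀ i : Fin m, Metric.diam (α '' Set.Icc (t i.castSucc) (t i.succ)) < r
  diam_wrap_lt : Metric.diam (α '' (Set.Icc 0 (t 0) ∪ Set.Icc (t (Fin.last m)) 1)) < r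

/-- The loop in `Rips(X, r)` given by an `r`-sample, through the vertices
`α (t 0), α (t 1), …, α (t m), α (t 0)`. -/
def Sample.loop {x : X} {α : Path x x} {r : ℝ} (s : Sample α r) (hr : 0 < r) :
    Path (Realization.vertex (rips X r hr) (α (s.t 0)))
      (Realization.vertex (rips X r hr) (α (s.t 0))) :=
  Realization.edgeLoop (rips X r hr) (fun i => α (s.t i))
    (fun i => pair_mem_rips hr ((isCompact_Icc.image α.continuous).isBounded) (s.diam_lt i)
      ⟨_, Set.left_mem_Icc.mpr (s.strictMono.monotone i.castSucc_lt_succ.le), rfl⟩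
      ⟨_, Set.right_mem_Icc.mpr (s.strictMono.monotone i.castSucc_lt_succ.le), rfl⟩)
    (pair_mem_rips hr (((isCompact_Icc.union isCompact_Icc).image α.continuous).isBounded)
      s.diam_wrap_lt
      ⟨_, Or.inr (Set.left_mem_Icc.mpr unitInterval.le_one'), rfl⟩
      ⟨_, Or.inl (Set.right_mem_Icc.mpr unitInterval.nonneg'), rfl⟩)

/-- The based loop in `Rips(X, r)` given by an `r`-sample with `t 0 = 0`. -/
def Sample.basedLoop {x : X} {α : Path x x} {r : ℝ} (s : Sample α r) (hs : s.t 0 = 0)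
    (hr : 0 < r) :
    Path (Realization.vertex (rips X r hr) x) (Realization.vertex (rips X r hr) x) :=
  (s.loop hr).cast (by rw [hs, α.source]) (by rw [hs, α.source])

end Rips

/-! ### Fundamental groups -/

section FundamentalGroup

/-- The class of a loop in the fundamental group. -/
def loopClass {Y : Type u} [TopologicalSpace Y] {y : Y} (α : Path y y) : FundamentalGroup Y y :=
  FundamentalGroup.fromPath (Path.Homotopic.Quotient.mk α)

variable (X : Type u) [MetricSpace X] (x₀ : X)

/-- `S(X, r, π₁)`: the subgroup of `π₁(X, x₀)` generated by the lassos `α * β * α⁻`, where `α` is a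
path from `x₀` and `β` is a loop contained in a closed ball of radius `d < r`. -/
def spanierPi (r : ℝ) : Subgroup (FundamentalGroup X x₀) :=
  Subgroup.closure {c | ∃ (y w : X) (d : ℝ) (α : Path x₀ y) (β : Path y y), d < r ∧
    Set.range β ⊆ Metric.closedBall w d ∧ c = loopClass ((α.trans β).trans α.symm)}

instance spanierPi_normal (r : ℝ) : (spanierPi X x₀ r).Normal := by
  refine ⟨fun n hn g => ?_⟩
  refine Subgroup.closure_induction (p := fun n _ => g * n * g⁻¹ ∈ spanierPi X x₀ r)
    ?_ ?_ ?_ ?_ hn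
  · rintro c ⟨y, w, d, α, β, hd, hβ, rfl⟩
    obtain ⟨γ, rfl⟩ := Path.Homotopic.Quotient.mk_surjective g
    refine Subgroup.subset_closure ⟨y, w, d, γ.symm.trans α, β, hd, hβ, ?_⟩
    simp only [loopClass, FundamentalGroup.mul_def, FundamentalGroup.inv_def, Path.trans_symm,
      Path.symm_symm, Path.Homotopic.Quotient.mk_trans, Path.Homotopic.Quotient.mk_symm,
      Path.Homotopic.Quotient.trans_assoc]
  · rw [mul_one, mul_inv_cancel]
    exact Subgroup.one_mem _
  · intro a b _ _ ha hb
    have h := Subgroup.mul_mem _ ha hb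
    rwa [show g * a * g⁻¹ * (g * b * g⁻¹) = g * (a * b) * g⁻¹ by group] at h
  · intro a _ ha
    have h := Subgroup.inv_mem _ ha
    rwa [show (g * a * g⁻¹)⁻¹ = g * a⁻¹ * g⁻¹ by group] at h

theorem spanierPi_mono {p q : ℝ} (h : p ≤ q) : spanierPi X x₀ p ≤ spanierPi X x₀ q :=
  Subgroup.closure_mono fun _ ⟨y, w, d, α, β, hd, hβ⟩ => ⟨y, w, d, α, β, hd.trans_le h, hβ⟩

/-- The bonding map `π₁(X, x₀) / S(X, p, π₁) → π₁(X, x₀) / S(X, q, π₁)`. -/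
def spanierPiBonding {p q : ℝ} (h : p ≤ q) :
    FundamentalGroup X x₀ ⧸ spanierPi X x₀ p →* FundamentalGroup X x₀ ⧸ spanierPi X x₀ q :=
  QuotientGroup.map _ _ (MonoidHom.id _) (spanierPi_mono X x₀ h)

/-- The map `π₁(Rips(X, p), x₀) → π₁(Rips(X, q), x₀)` induced by the bonding map. -/
def ripsPiBonding {p q : ℝ} (hp : 0 < p) (hpq : p < q) :
    FundamentalGroup (Rips X p hp) (Realization.vertex _ x₀) →*
      FundamentalGroup (Rips X q (hp.trans hpq)) (Realization.vertex _ x₀) :=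
  FundamentalGroup.mapOfEq (bonding X hp hpq) (Realization.incl_vertex _ x₀)

end FundamentalGroup

/-! ### First homology groups -/

section Homology

/-- The singular chain complex of `Y` with coefficients in `G`. -/
abbrev singularChains (Y : Type u) [TopologicalSpace Y] (G : Type v) [AddCommGroup G] :
    ChainComplex AddCommGrpCat.{max u v} ℕ :=
  (TopCat.toSSet.obj (TopCat.of Y)).chainComplex (AddCommGrpCat.of (ULift.{u} G))

/-- The first singular homology group `H₁(Y; G)`. -/
abbrev H₁ (Y : Type u) [TopologicalSpace Y] (G : Type v) [AddCommGroup G] :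
    AddCommGrpCat.{max u v} :=
  ((AlgebraicTopology.singularHomologyFunctor AddCommGrpCat.{max u v} 1).obj
    (AddCommGrpCat.of (ULift.{u} G))).obj (TopCat.of Y)

/-- The homomorphism `H₁(Y; G) → H₁(Z; G)` induced by a continuous map. -/
def H₁map {Y Z : Type u} [TopologicalSpace Y] [TopologicalSpace Z] (f : C(Y, Z))
    (G : Type v) [AddCommGroup G] : H₁ Y G →+ H₁ Z G :=
  (((AlgebraicTopology.singularHomologyFunctor AddCommGrpCat.{max u v} 1).obj
    (AddCommGrpCat.of (ULift.{u} G))).map (TopCat.ofHom f)).hom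

section Cycle

variable {Y : Type u} [TopologicalSpace Y] {y : Y} (α : Path y y) (G : Type v) [AddCommGroup G]

/-- A loop as a singular `1`-simplex. -/
def loopSimplex : (TopCat.toSSet.obj (TopCat.of Y)).obj (Opposite.op (SimplexCategory.mk 1)) :=
  TopCat.toSSetObj₁Equiv.symm (TopCat.pathEquiv (X := TopCat.of Y).symm α).hom

/-- The homomorphism from `G` to the singular `1`-chains sending `g` to the chain `g • α`. -/
def loopChain : AddCommGrpCat.of (ULift.{u} G) ⟶ (singularChains Y G).X 1 :=
  SSet.ιChainComplex _ (loopSimplex α)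

theorem loopChain_d : loopChain α G ≫ (singularChains Y G).d 1 0 = 0 := by
  rw [loopChain, SSet.ιChainComplex_d]
  have h0 := (TopCat.pathEquiv (X := TopCat.of Y).symm α).hom₀
  have h1 := (TopCat.pathEquiv (X := TopCat.of Y).symm α).hom₁
  simp [Fin.sum_univ_two, loopSimplex, h0, h1]

/-- The homology class of the cycle `g • α`, as a homomorphism in `g`. -/
def loopHom : G →+ H₁ Y G :=
  ((singularChains Y G).liftCycles (loopChain α G) 0 (by simp) (loopChain_d α G) ≫
    (singularChains Y G).homologyπ 1).hom.comp AddEquiv.ulift.symm.toAddMonoidHom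

end Cycle

variable (X : Type u) [MetricSpace X] (G : Type v) [AddCommGroup G]

/-- `S(X, r, G)`: the subgroup of `H₁(X; G)` generated by the classes of the cycles `g • β`, where
`β` is a loop contained in a closed ball of radius `d < r`. -/
def spanierH (r : ℝ) : AddSubgroup (H₁ X G) :=
  AddSubgroup.closure {c | ∃ (y w : X) (d : ℝ) (β : Path y y) (g : G), d < r ∧
    Set.range β ⊆ Metric.closedBall w d ∧ c = loopHom β G g}

theorem spanierH_mono {p q : ℝ} (h : p ≤ q) : spanierH X G p ≤ spanierH X G q :=
  AddSubgroup.closure_mono fun _ ⟨y, w, d, β, g, hd, hβ⟩ => ⟨y, w, d, β, g, hd.trans_le h, hβ⟩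

/-- The bonding map `H₁(X; G) / S(X, p, G) → H₁(X; G) / S(X, q, G)`. -/
def spanierHBonding {p q : ℝ} (h : p ≤ q) :
    H₁ X G ⧸ spanierH X G p →+ H₁ X G ⧸ spanierH X G q :=
  QuotientAddGroup.map _ _ (AddMonoidHom.id _) (spanierH_mono X G h)

/-- The map `H₁(Rips(X, p); G) → H₁(Rips(X, q); G)` induced by the bonding map. -/
def ripsHBonding {p q : ℝ} (hp : 0 < p) (hpq : p < q) :
    H₁ (Rips X p hp) G →+ H₁ (Rips X q (hp.trans hpq)) G :=
  H₁map (bonding X hp hpq) G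

end Homology

end RipsSpanier

end

/-! A *path homomorphism* from a space `Y` to a group `Q` is a functor from the fundamental groupoid
of `Y` to `Q`. Fix a scale `r`.

* A path homomorphism `F` on `Rips(X, r)` restricts to the edges as a cocycle on the pairs of points
  of `X` at distance `< r`. Gluing trivial coverings of small open sets along this cocycle and
  taking monodromy gives a path homomorphism `Φ` on `X`, whose value on a based loop is the value of
  `F` on every `r`-sample. It kills the loops in a ball of radius `d < 3r/2`, because the cocycle is
  trivial there: go from the center to a point of the ball through the point at two thirds of a
  geodesic.
* Conversely, if `Φ` kills these loops, its values on geodesics of length `< r` form a cocycle,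
  since a geodesic triangle with sides `< r` lies in a ball of radius `< 3r/2` around a vertex. The
  cocycle extends over the open stars of the vertices to a path homomorphism on `Rips(X, r)`.

So `Rips(X, r)` has the same path homomorphisms as `X` modulo the loops in balls of radius
`< 3r/2`, hence the same fundamental group. For homology, take `Q = Hom(G, A)`: on loops, such path
homomorphisms on `Y` amount to homomorphisms `H₁(Y; G) → A`, since `H₁(Y; G)` is generated by the
classes of the loops `g • α`. -/

noncomputable section

namespace RipsSpanier

open unitInterval

/-! ### Homomorphisms from paths to a group -/

section PathHom

variable {Y : Type*} [TopologicalSpace Y]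

theorem path_induction_of_openCover {P : ∀ {p q : Y}, Path p q → Prop}
    (homotopic : ∀ {p q : Y} {γ δ : Path p q}, γ.Homotopic δ → P γ → P δ)
    (trans : ∀ {p q s : Y} (γ : Path p q) (δ : Path q s), P γ → P δ → P (γ.trans δ))
    {x y : Y} (γ : Path x y) {𝒰 : Set (Set Y)} (isOpen : ∀ U ∈ 𝒰, IsOpen U)
    (cover : ∀ t, ∃ U ∈ 𝒰, γ t ∈ U)
    (small : ∀ s t : I, ∀ U ∈ 𝒰, Set.range (γ.subpath s t) ⊆ U → P (γ.subpath s t)) :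
    P γ := by
  obtain ⟨t, t_zero, t_mono, ⟨n, t_eq_one⟩, t_small⟩ :=
    exists_monotone_Icc_subset_open_cover_unitInterval (c := fun U : 𝒰 => γ ⁻¹' U.1)
      (fun U => (isOpen _ U.2).preimage γ.continuous)
      (fun s _ => let ⟨U, hU, hs⟩ := cover s; Set.mem_iUnion.mpr ⟨⟨U, hU⟩, hs⟩)
  have consecutive : ∀ k, P (γ.subpath (t k) (t (k + 1))) := fun k => by
    obtain ⟨U, hk⟩ := t_small k
    refine small _ _ _ U.2 ?_
    rw [Path.range_subpath_of_le _ _ _ (t_mono k.le_succ), Set.image_subset_iff]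
    exact hk
  have initial : ∀ k, P (γ.subpath (t 0) (t (k + 1))) := fun k => by
    induction k with
    | zero => exact consecutive 0
    | succ k ih =>
      exact homotopic ⟨Path.Homotopy.subpathTransSubpath γ _ _ _⟩
        (trans _ _ ih (consecutive (k + 1)))
  have of_cast : ∀ {x' y' : Y} (hx : x' = x) (hy : y' = y), P (γ.cast hx hy) → P γ := by
    rintro _ _ rfl rfl h
    exact h
  have whole := initial n
  rw [t_zero, t_eq_one (n + 1) n.le_succ, Path.subpath_zero_one] at whole
  exact of_cast _ _ whole

variable (Y) in
/-- A functor from the fundamental groupoid of `Y` to the one-object groupoid of `Q`, encoded by its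
values on paths. The order of the factors in `map_trans` is that of Mathlib's `FundamentalGroup`. -/
structure PathHom (Q : Type*) [Group Q] where
  toFun : ∀ {p q : Y}, Path p q → Q
  map_homotopic : ∀ {p q : Y} {γ δ : Path p q}, γ.Homotopic δ → toFun γ = toFun δ
  map_trans : ∀ {p q s : Y} (γ : Path p q) (δ : Path q s),
    toFun (γ.trans δ) = toFun δ * toFun γ

namespace PathHom

variable {Q : Type*} [Group Q] (F : PathHom Y Q)

instance : CoeFun (PathHom Y Q) fun _ => ∀ {p q : Y}, Path p q → Q := ⟨@PathHom.toFun Y _ Q _⟩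

instance : One (PathHom Y Q) := ⟨⟨fun _ => 1, fun _ => rfl, fun _ _ => (one_mul 1).symm⟩⟩

theorem one_apply {p q : Y} (γ : Path p q) : (1 : PathHom Y Q) γ = 1 := rfl

theorem trans_apply {p q s : Y} (γ : Path p q) (δ : Path q s) : F (γ.trans δ) = F δ * F γ :=
  F.map_trans γ δ

theorem refl_apply (p : Y) : F (Path.refl p) = 1 := by
  have h := F.trans_apply (Path.refl p) (Path.refl p)
  rw [Path.refl_trans_refl] at h
  exact left_eq_mul.mp h

theorem symm_apply {p q : Y} (γ : Path p q) : F γ.symm = (F γ)⁻¹ := by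
  refine eq_inv_of_mul_eq_one_left ?_
  rw [← trans_apply, F.map_homotopic (Path.Homotopic.trans_symm γ), refl_apply]

theorem congr {p q p' q' : Y} (γ : Path p q) (δ : Path p' q') (h : ∀ t, γ t = δ t) : F γ = F δ := by
  obtain rfl : p = p' := by simpa only [Path.source] using h 0
  obtain rfl : q = q' := by simpa only [Path.target] using h 1
  rw [Path.ext (funext h)]

theorem subpath_mul_subpath {p q : Y} (γ : Path p q) (a b c : I) :
    F (γ.subpath b c) * F (γ.subpath a b) = F (γ.subpath a c) := by
  rw [← trans_apply]
  exact F.map_homotopic ⟨Path.Homotopy.subpathTransSubpath γ _ _ _⟩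

theorem subpath_zero_one {p q : Y} (γ : Path p q) : F (γ.subpath 0 1) = F γ :=
  F.congr _ _ fun t => by rw [Path.subpath_zero_one, Path.cast_coe]

/-- The homomorphism `π₁(Y, y) → Q` given by the values on loops at `y`. -/
def toMonoidHom (y : Y) : FundamentalGroup Y y →* Q where
  toFun c := Quotient.lift (s := Path.Homotopic.setoid y y) (fun γ : Path y y => F γ)
    (fun _ _ h => F.map_homotopic h) c
  map_one' := F.refl_apply y
  map_mul' a b := by
    obtain ⟨a, rfl⟩ := Path.Homotopic.Quotient.mk_surjective a
    obtain ⟨b, rfl⟩ := Path.Homotopic.Quotient.mk_surjective b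
    exact F.map_trans b a

/-- The path homomorphism `f ∘ F`. -/
def comp {R : Type*} [Group R] (f : Q →* R) : PathHom Y R where
  toFun γ := f (F γ)
  map_homotopic h := by rw [F.map_homotopic h]
  map_trans γ δ := by rw [F.map_trans, map_mul]

/-- The pullback of a path homomorphism along a continuous map. -/
def comap {Z : Type*} [TopologicalSpace Z] (f : C(Z, Y)) : PathHom Z Q where
  toFun γ := F (γ.map f.continuous)
  map_homotopic h := F.map_homotopic (h.map f)
  map_trans γ δ := by rw [Path.map_trans, F.map_trans]

theorem comap_apply {Z : Type*} [TopologicalSpace Z] (f : C(Z, Y)) {p q : Z} (γ : Path p q) :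
    F.comap f γ = F (γ.map f.continuous) := rfl

theorem eq_of_simplyConnectedSpace [SimplyConnectedSpace Y] {p q : Y} (γ δ : Path p q) :
    F γ = F δ :=
  F.map_homotopic (SimplyConnectedSpace.paths_homotopic γ δ)

/-- `b` is a natural transformation from `F'` to `F`, both regarded as functors. -/
def ConjBy (F F' : PathHom Y Q) (b : Y → Q) : Prop :=
  ∀ ⦃p q : Y⦄ (γ : Path p q), F γ = b q * F' γ * (b p)⁻¹

variable {F} in
theorem ConjBy.apply_eq_of_eq_one {F' : PathHom Y Q} {b : Y → Q} (h : F.ConjBy F' b) {p : Y}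
    (hp : b p = 1) (γ : Path p p) : F γ = F' γ := by
  rw [h γ, hp, one_mul, inv_one, mul_one]

variable {F} in
theorem exists_conjBy_of_loops_eq [PathConnectedSpace Y] {F' : PathHom Y Q} (y₀ : Y)
    (h : ∀ α : Path y₀ y₀, F α = F' α) : ∃ b : Y → Q, b y₀ = 1 ∧ F.ConjBy F' b := by
  let C (p : Y) : Path y₀ p := PathConnectedSpace.somePath y₀ p
  refine ⟨fun p => F (C p) * (F' (C p))⁻¹, mul_inv_eq_one.mpr (h _), fun p q γ => ?_⟩
  have loop_eq := h (((C p).trans γ).trans (C q).symm)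
  simp only [trans_apply, symm_apply] at loop_eq
  calc F γ = F (C q) * ((F (C q))⁻¹ * (F γ * F (C p))) * (F (C p))⁻¹ := by group
    _ = F (C q) * (F' (C q))⁻¹ * F' γ * (F (C p) * (F' (C p))⁻¹)⁻¹ := by
      rw [loop_eq]
      group

theorem mul_eq_mul_of_square (H : C(I × I, Y)) {p q p' q' : Y} (bottom : Path p q)
    (left : Path p p') (right : Path q q') (top : Path p' q') (h_bottom : ∀ t, H (t, 0) = bottom t)
    (h_left : ∀ t, H (0, t) = left t) (h_right : ∀ t, H (1, t) = right t)
    (h_top : ∀ t, H (t, 1) = top t) : F right * F bottom = F top * F left := by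
  have : ContractibleSpace I := (convex_Icc (0 : ℝ) 1).contractibleSpace ⟨0, zero_mem⟩
  let ι : Path (0 : I) 1 := ⟨ContinuousMap.id I, rfl, rfl⟩
  calc F right * F bottom
      = F.comap H ((ι.prod (Path.refl 0)).trans ((Path.refl 1).prod ι)) := by
        rw [trans_apply]
        exact (congrArg₂ _ (F.congr _ _ h_right) (F.congr _ _ h_bottom)).symm
    _ = F.comap H (((Path.refl 0).prod ι).trans (ι.prod (Path.refl 1))) :=
        (F.comap H).eq_of_simplyConnectedSpace _ _
    _ = F top * F left := by
        rw [trans_apply]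
        exact congrArg₂ _ (F.congr _ _ h_top) (F.congr _ _ h_left)

theorem eq_conj_of_locally_eq_conj (F' : PathHom Y Q) (b : Y → Q) {x y : Y} (γ : Path x y)
    {𝒰 : Set (Set Y)} (isOpen : ∀ U ∈ 𝒰, IsOpen U) (cover : ∀ t, ∃ U ∈ 𝒰, γ t ∈ U)
    (h : ∀ s t : I, ∀ U ∈ 𝒰, Set.range (γ.subpath s t) ⊆ U →
      F (γ.subpath s t) = b (γ t) * F' (γ.subpath s t) * (b (γ s))⁻¹) :
    F γ = b y * F' γ * (b x)⁻¹ := by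
  refine path_induction_of_openCover (P := fun {p q} δ => F δ = b q * F' δ * (b p)⁻¹) ?_ ?_ γ
    isOpen cover h
  · intro p q γ δ hγ h
    rw [← F.map_homotopic hγ, ← F'.map_homotopic hγ, h]
  · intro p q s γ δ hγ hδ
    rw [trans_apply, trans_apply, hγ, hδ]
    group

end PathHom

/-! ### Local cocycles -/

section LocalCocycle

variable {Q : Type*} [Group Q] (𝒰 : Set (Set Y)) (c : Y → Y → Q)

/-- The cocycle identity for `c` on each member of an open cover `𝒰`. Nothing is required of
`c p q` when no member of `𝒰` contains both points. -/
structure IsLocalCocycle : Prop where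
  isOpen : ∀ U ∈ 𝒰, IsOpen U
  exists_mem : ∀ p : Y, ∃ U ∈ 𝒰, p ∈ U
  mul_eq : ∀ U ∈ 𝒰, ∀ p ∈ U, ∀ q ∈ U, ∀ s ∈ U, c q s * c p q = c p s

variable {𝒰 c}

namespace IsLocalCocycle

variable (h : IsLocalCocycle 𝒰 c)
include h

theorem self_eq_one (p : Y) : c p p = 1 := by
  obtain ⟨U, hU, hp⟩ := h.exists_mem p
  exact left_eq_mul.mp (h.mul_eq U hU p hp p hp p hp).symm

theorem inv_eq {U : Set Y} (hU : U ∈ 𝒰) {p q : Y} (hp : p ∈ U) (hq : q ∈ U) :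
    (c p q)⁻¹ = c q p :=
  inv_eq_of_mul_eq_one_left ((h.mul_eq U hU p hp q hq p hp).trans (h.self_eq_one p))

section Transport

variable [TopologicalSpace Q] [DiscreteTopology Q]

/-- The principal bundle with discrete fiber `Q` glued from the trivial bundles over the members of
the cover. A chart is a member of the cover together with one of its points, from which the fiber
coordinate is measured. -/
def bundleCore : FiberBundleCore {i : Set Y × Y // i.1 ∈ 𝒰 ∧ i.2 ∈ i.1} Y Q where
  baseSet i := i.1.1
  isOpen_baseSet i := h.isOpen _ i.2.1
  indexAt p := ⟨((h.exists_mem p).choose, p), (h.exists_mem p).choose_spec⟩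
  mem_baseSet_at p := (h.exists_mem p).choose_spec.2
  coordChange i j x v := c x j.1.2 * (c x i.1.2)⁻¹ * v
  coordChange_self i x _ v := by rw [mul_inv_cancel, one_mul]
  continuousOn_coordChange i j := by
    rintro ⟨x, v⟩ ⟨⟨hxi, hxj⟩, -⟩
    have locally_constant : ∀ y ∈ i.1.1 ∩ j.1.1,
        c y j.1.2 * (c y i.1.2)⁻¹ = c x j.1.2 * (c x i.1.2)⁻¹ := by
      rintro y ⟨hyi, hyj⟩
      rw [← h.mul_eq _ i.2.1 y hyi x hxi _ i.2.2, ← h.mul_eq _ j.2.1 y hyj x hxj _ j.2.2]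
      group
    have h_cont : Continuous fun p : Y × Q => c x j.1.2 * (c x i.1.2)⁻¹ * p.2 :=
      (continuous_of_discreteTopology (f := (c x j.1.2 * (c x i.1.2)⁻¹ * ·))).comp continuous_snd
    exact h_cont.continuousOn.congr (fun p hp => by simp only [locally_constant p.1 hp.1])
      (x, v) ⟨⟨hxi, hxj⟩, trivial⟩
  coordChange_comp i j k x _ v := by group

theorem isCoveringMap_proj :
    IsCoveringMap (Bundle.TotalSpace.proj : Bundle.TotalSpace Q h.bundleCore.Fiber → Y) :=
  FiberBundle.isCoveringMap (F := Q) (E := h.bundleCore.Fiber)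

/-- The monodromy of the bundle along a path, in the fiber coordinates at the two endpoints. -/
def transport {p q : Y} (γ : Path p q) (a : Q) : Q :=
  (h.isCoveringMap_proj.monodromy (.mk γ)
    ⟨(⟨p, a⟩ : Bundle.TotalSpace Q h.bundleCore.Fiber), rfl⟩).1.2

theorem monodromy_mk {p q : Y} (γ : Path p q) (a : Q) :
    h.isCoveringMap_proj.monodromy (.mk γ)
        ⟨(⟨p, a⟩ : Bundle.TotalSpace Q h.bundleCore.Fiber), rfl⟩ =
      ⟨(⟨q, h.transport γ a⟩ : Bundle.TotalSpace Q h.bundleCore.Fiber), rfl⟩ :=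
  Subtype.ext (Bundle.TotalSpace.ext (h.isCoveringMap_proj.monodromy (.mk γ) _).2 HEq.rfl)

theorem transport_eq_of_homotopic {p q : Y} {γ δ : Path p q} (hγ : γ.Homotopic δ) (a : Q) :
    h.transport γ a = h.transport δ a := by
  rw [transport, Path.Homotopic.Quotient.eq.mpr hγ, transport]

theorem transport_trans {p q s : Y} (γ : Path p q) (δ : Path q s) (a : Q) :
    h.transport (γ.trans δ) a = h.transport δ (h.transport γ a) := by
  have h_trans := h.isCoveringMap_proj.monodromy_trans_apply (.mk γ) (.mk δ) ⟨⟨p, a⟩, rfl⟩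
  rw [h.monodromy_mk γ a, h.monodromy_mk δ] at h_trans
  exact congrArg (fun e => (e.1.2 : Q)) h_trans

theorem transport_of_range_subset {U : Set Y} (hU : U ∈ 𝒰) {p q : Y} {γ : Path p q}
    (hγ : Set.range γ ⊆ U) (a : Q) : h.transport γ a = c p q * a := by
  have hp : p ∈ U := hγ ⟨0, γ.source⟩
  have hq : q ∈ U := hγ ⟨1, γ.target⟩
  let i : {i : Set Y × Y // i.1 ∈ 𝒰 ∧ i.2 ∈ i.1} := ⟨(U, p), hU, hp⟩
  -- The lift of `γ` from `(p, a)` is constant in the chart `i`.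
  let lift : I → Bundle.TotalSpace Q h.bundleCore.Fiber := fun t => ⟨γ t, (c (γ t) p)⁻¹ * a⟩
  have lift_chart :
      lift = fun t => (h.bundleCore.localTriv i).toOpenPartialHomeomorph.symm (γ t, a) := by
    funext t
    refine Bundle.TotalSpace.ext rfl (heq_of_eq ?_)
    change _ = c (γ t) (γ t) * (c (γ t) p)⁻¹ * a
    rw [h.self_eq_one, one_mul]
  have continuous_lift : Continuous lift := by
    rw [lift_chart]
    refine (h.bundleCore.localTriv i).toOpenPartialHomeomorph.continuousOn_symm.comp_continuous
      (by fun_prop) fun t => ?_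
    rw [Bundle.Trivialization.mem_target]
    exact hγ ⟨t, rfl⟩
  have lift_eq : lift = h.isCoveringMap_proj.liftPath γ ⟨p, a⟩ γ.source := by
    rw [h.isCoveringMap_proj.eq_liftPath_iff]
    refine ⟨continuous_lift, rfl, Bundle.TotalSpace.ext γ.source (heq_of_eq ?_)⟩
    change (c (γ 0) p)⁻¹ * a = a
    rw [γ.source, h.self_eq_one, inv_one, one_mul]
  have lift_one : h.transport γ a = (c (γ 1) p)⁻¹ * a :=
    (congrArg (fun e : Bundle.TotalSpace Q h.bundleCore.Fiber => (e.2 : Q))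
      (congrFun lift_eq 1)).symm
  rw [lift_one, γ.target, h.inv_eq hU hq hp]

theorem transport_eq_mul {p q : Y} (γ : Path p q) (a : Q) :
    h.transport γ a = h.transport γ 1 * a := by
  refine path_induction_of_openCover
    (P := fun {p q} γ => ∀ a, h.transport γ a = h.transport γ 1 * a) ?_ ?_ γ h.isOpen
    (fun t => h.exists_mem _) ?_ a
  · intro p q γ δ hγ hmul a
    rw [← h.transport_eq_of_homotopic hγ, ← h.transport_eq_of_homotopic hγ, hmul]
  · intro p q s γ δ hγ hδ a
    rw [transport_trans, transport_trans, hδ, hγ, hδ (h.transport γ 1), mul_assoc]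
  · intro s t U hU hs a
    rw [h.transport_of_range_subset hU hs, h.transport_of_range_subset hU hs, mul_one]

end Transport

theorem exists_pathHom : ∃ F : PathHom Y Q, ∀ U ∈ 𝒰, ∀ {p q : Y} (γ : Path p q),
    Set.range γ ⊆ U → F γ = c p q := by
  let _ : TopologicalSpace Q := ⊥
  have : DiscreteTopology Q := ⟨rfl⟩
  refine ⟨⟨fun γ => h.transport γ 1, fun hγ => h.transport_eq_of_homotopic hγ 1, fun γ δ => ?_⟩,
    fun U hU p q γ hγ => ?_⟩
  · rw [transport_trans, transport_eq_mul]
  · exact (h.transport_of_range_subset hU hγ 1).trans (mul_one _)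

end IsLocalCocycle

end LocalCocycle

section BasePaths

theorem exists_basePaths [PathConnectedSpace Y] (y₀ : Y) :
    ∃ C : ∀ p, Path y₀ p, C y₀ = Path.refl y₀ := by
  classical
  exact ⟨fun p => if h : p = y₀ then (Path.refl y₀).cast rfl h else
    PathConnectedSpace.somePath y₀ p, dif_pos rfl⟩

/-- The path homomorphism to the fundamental group which closes up a path by the base paths `C` to
its endpoints. -/
def PathHom.ofBasePaths {y₀ : Y} (C : ∀ p, Path y₀ p) : PathHom Y (FundamentalGroup Y y₀) where
  toFun {p q} γ := loopClass (((C p).trans γ).trans (C q).symm)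
  map_homotopic h := Path.Homotopic.Quotient.eq.mpr
    (((Path.Homotopic.refl _).hcomp h).hcomp (Path.Homotopic.refl _))
  map_trans γ δ := by
    simp only [loopClass, FundamentalGroup.mul_def, Path.Homotopic.Quotient.mk_trans,
      Path.Homotopic.Quotient.mk_symm]
    grind

theorem PathHom.ofBasePaths_loop {y₀ : Y} {C : ∀ p, Path y₀ p} (hC : C y₀ = Path.refl y₀)
    (γ : Path y₀ y₀) :
    PathHom.ofBasePaths C γ = loopClass γ := by
  simp [PathHom.ofBasePaths, loopClass, hC, -Path.Homotopic.Quotient.mk_symm]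

end BasePaths

end PathHom

/-! ### Paths in the realization of a simplicial complex -/

namespace Realization

section Segment

variable {ι : Type*} [Fintype ι]

/-- The point dividing the segment from `a` to `b` in the ratio `t : 1 - t`, as a function of
`(a, b, t)`. -/
def stdSimplexSegment : C(stdSimplex ℝ ι × stdSimplex ℝ ι × I, stdSimplex ℝ ι) where
  toFun x := ⟨fun i => (1 - (x.2.2 : ℝ)) * x.1.1 i + x.2.2 * x.2.1.1 i,
    convex_stdSimplex ℝ ι x.1.2 x.2.1.2 (sub_nonneg.mpr x.2.2.2.2) x.2.2.2.1
      (sub_add_cancel _ _)⟩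
  continuous_toFun := by
    refine Continuous.subtype_mk (continuous_pi fun i => ?_) _
    have h_left : Continuous fun x : stdSimplex ℝ ι × stdSimplex ℝ ι × I => x.1.1 i :=
      (continuous_apply i).comp (continuous_subtype_val.comp continuous_fst)
    have h_right : Continuous fun x : stdSimplex ℝ ι × stdSimplex ℝ ι × I => x.2.1.1 i :=
      (continuous_apply i).comp (continuous_subtype_val.comp (continuous_fst.comp continuous_snd))
    fun_prop

/-- The segment from `a` to `b` as a path. -/
def stdSimplexPath (a b : stdSimplex ℝ ι) : Path a b where
  toFun t := stdSimplexSegment (a, b, t)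
  source' := Subtype.ext (by simp [stdSimplexSegment])
  target' := Subtype.ext (by simp [stdSimplexSegment])

end Segment

variable {V : Type u} {K : AbstractSimplicialComplex V}

theorem exists_face_of_apply_ne_zero (p : Realization K) :
    ∃ s ∈ K.faces, ∀ v, p.1 v ≠ 0 → v ∈ s := by
  obtain ⟨s, hs, hp, -⟩ := p.2.2
  exact ⟨s, hs, fun v => not_imp_comm.mp (hp v)⟩

theorem exists_ne_zero (p : Realization K) : ∃ v, p.1 v ≠ 0 := by
  obtain ⟨s, -, -, hp⟩ := p.2.2
  obtain ⟨v, -, hv⟩ := Finset.exists_ne_zero_of_sum_ne_zero (hp.trans_ne one_ne_zero)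
  exact ⟨v, hv⟩

theorem sum_eq_one (p : Realization K) {s : Finset V} (h : ∀ v ∉ s, p.1 v = 0) :
    ∑ v ∈ s, p.1 v = 1 := by
  classical
  obtain ⟨t, -, hpt, ht⟩ := p.2.2
  calc ∑ v ∈ s, p.1 v = ∑ v ∈ s ∪ t, p.1 v :=
        Finset.sum_subset Finset.subset_union_left fun v _ hv => h v hv
    _ = ∑ v ∈ t, p.1 v :=
        (Finset.sum_subset Finset.subset_union_right fun v _ hv => hpt v hv).symm
    _ = 1 := ht

theorem vertex_apply_ne {x v : V} (h : v ≠ x) : (vertex K x).1 v = 0 := if_neg h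

theorem vertex_apply_self (x : V) : (vertex K x).1 x = 1 := if_pos rfl

/-- The barycentric coordinates of `p` in a closed simplex which contains it. -/
def coords {s : Finset V} (p : Realization K) (h : ∀ v ∉ s, p.1 v = 0) : stdSimplex ℝ s :=
  ⟨fun v => p.1 v, fun v => p.2.1 v, (Finset.sum_coe_sort s p.1).trans (sum_eq_one p h)⟩

theorem cell_coords {s : Finset V} (hs : s ∈ K.faces) (p : Realization K)
    (h : ∀ v ∉ s, p.1 v = 0) : cell ⟨s, hs⟩ (coords p h) = p := by
  classical
  refine Subtype.ext (funext fun v => ?_)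
  by_cases hv : v ∈ s
  · exact dif_pos hv
  · exact (dif_neg hv).trans (h v hv).symm

theorem cell_stdSimplexSegment (s : K.faces) (a b : stdSimplex ℝ (s : Finset V)) (t : I) (v : V) :
    (cell s (stdSimplexSegment (a, b, t))).1 v =
      (1 - (t : ℝ)) * (cell s a).1 v + t * (cell s b).1 v := by
  classical
  by_cases hv : v ∈ (s : Finset V) <;> simp [cell, stdSimplexSegment, hv]

/-- The set `s` is a face whose closed simplex contains the points `p` and `q`. -/
def Carries (K : AbstractSimplicialComplex V) (s : Finset V) (p q : Realization K) : Prop :=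
  s ∈ K.faces ∧ (∀ v ∉ s, p.1 v = 0) ∧ ∀ v ∉ s, q.1 v = 0

theorem carries_vertex_vertex {s : Finset V} (hs : s ∈ K.faces) {x y : V} (hx : x ∈ s)
    (hy : y ∈ s) : Carries K s (vertex K x) (vertex K y) :=
  ⟨hs, fun _ hv => vertex_apply_ne (ne_of_mem_of_not_mem hx hv).symm,
    fun _ hv => vertex_apply_ne (ne_of_mem_of_not_mem hy hv).symm⟩

/-- The straight path between two points of a common closed simplex. By `line_apply` it does not
depend on the choice of the simplex. -/
def line {p q : Realization K} (h : ∃ s, Carries K s p q) : Path p q :=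
  ((stdSimplexPath (coords p h.choose_spec.2.1) (coords q h.choose_spec.2.2)).map
    (continuous_cell ⟨h.choose, h.choose_spec.1⟩)).cast
    (cell_coords _ _ _).symm (cell_coords _ _ _).symm

theorem line_apply {p q : Realization K} (h : ∃ s, Carries K s p q) (t : I) (v : V) :
    (line h t).1 v = (1 - (t : ℝ)) * p.1 v + t * q.1 v := by
  refine (cell_stdSimplexSegment ⟨_, h.choose_spec.1⟩ _ _ t v).trans ?_
  rw [cell_coords, cell_coords]

open Classical in
theorem edge_apply {x y : V} (h : ∃ s, Carries K s (vertex K x) (vertex K y))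
    (hxy : ({x, y} : Finset V) ∈ K.faces) (t : I) : edge K hxy t = line h t := by
  refine Subtype.ext (funext fun v => ?_)
  rw [line_apply]
  change (if v ∈ ({x, y} : Finset V) then
    (1 - (t : ℝ)) * (if v = x then 1 else 0) + t * (if v = y then 1 else 0) else 0) = _
  by_cases hx : v = x <;> by_cases hy : v = y <;> simp [vertex, hx, hy]

section EdgeValue

variable {Q : Type*} [Group Q] (F : PathHom (Realization K) Q)

theorem apply_line_eq_comap_cell {s : Finset V} (hs : s ∈ K.faces) {p q : Realization K}
    (hp : ∀ v ∉ s, p.1 v = 0) (hq : ∀ v ∉ s, q.1 v = 0) (δ : Path (coords p hp) (coords q hq)) :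
    F (line ⟨s, hs, hp, hq⟩) = F.comap ⟨cell ⟨s, hs⟩, continuous_cell _⟩ δ := by
  have : ContractibleSpace (stdSimplex ℝ s) :=
    (convex_stdSimplex ℝ s).contractibleSpace ⟨_, (coords p hp).2⟩
  rw [(F.comap _).eq_of_simplyConnectedSpace δ (stdSimplexPath _ _), PathHom.comap_apply]
  refine F.congr _ _ fun t => Subtype.ext (funext fun v => ?_)
  rw [line_apply]
  refine Eq.trans ?_ (cell_stdSimplexSegment ⟨s, hs⟩ _ _ t v).symm
  rw [cell_coords, cell_coords]

theorem apply_line_mul_apply_line {s : Finset V} {p q w : Realization K} (hpq : Carries K s p q)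
    (hqw : Carries K s q w) :
    F (line ⟨s, hqw⟩) * F (line ⟨s, hpq⟩) = F (line ⟨s, hpq.1, hpq.2.1, hqw.2.2⟩) := by
  rw [apply_line_eq_comap_cell F hpq.1 hpq.2.1 hpq.2.2 (stdSimplexPath _ _),
    apply_line_eq_comap_cell F hpq.1 hpq.2.2 hqw.2.2 (stdSimplexPath _ _),
    apply_line_eq_comap_cell F hpq.1 hpq.2.1 hqw.2.2
      ((stdSimplexPath _ _).trans (stdSimplexPath _ _)),
    PathHom.trans_apply]

open Classical in
/-- The value of a path homomorphism on the edge from `x` to `y`, and the junk value `1` if `x` and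
`y` do not span a face. -/
def edgeValue (x y : V) : Q :=
  if h : ({x, y} : Finset V) ∈ K.faces then F (edge K h) else 1

open Classical in
theorem apply_edge {x y : V} (h : ({x, y} : Finset V) ∈ K.faces) :
    F (edge K h) = edgeValue F x y := by
  rw [edgeValue, dif_pos h]

theorem edgeValue_comp {R : Type*} [Group R] (f : Q →* R) (x y : V) :
    edgeValue (F.comp f) x y = f (edgeValue F x y) := by
  rw [edgeValue, edgeValue, apply_dite f, map_one]
  rfl

theorem edgeValue_eq_apply_line {s : Finset V} (hs : s ∈ K.faces) {x y : V} (hx : x ∈ s)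
    (hy : y ∈ s) :
    edgeValue F x y = F (line ⟨s, carries_vertex_vertex hs hx hy⟩) := by
  classical
  have hxy : ({x, y} : Finset V) ∈ K.faces := by
    refine (K.isRelLowerSet_faces hs).2 ?_ (Finset.insert_nonempty x {y})
    rintro v hv
    rcases Finset.mem_insert.mp hv with rfl | hv
    exacts [hx, Finset.mem_singleton.mp hv ▸ hy]
  refine (dif_pos ?_).trans (F.congr _ _ fun t => edge_apply _ ?_ t) <;> convert hxy

end EdgeValue

section OpenStar

/-- The open star of a vertex. -/
def openStar (K : AbstractSimplicialComplex V) (u : V) : Set (Realization K) := {p | p.1 u ≠ 0}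

theorem isOpen_iff {W : Set (Realization K)} : IsOpen W ↔ ∀ s : K.faces, IsOpen (cell s ⁻¹' W) := by
  rw [isOpen_iSup_iff]
  exact forall_congr' fun s => isOpen_coinduced

theorem preimage_cell_openStar_of_notMem {s : K.faces} {u : V} (hu : u ∉ (s : Finset V)) :
    cell s ⁻¹' openStar K u = ∅ :=
  Set.eq_empty_of_forall_notMem fun _ hw => hw (dif_neg hu)

theorem isOpen_openStar (u : V) : IsOpen (openStar K u) := by
  classical
  refine isOpen_iff.mpr fun s => ?_
  by_cases hu : u ∈ (s : Finset V)
  · have h : cell s ⁻¹' openStar K u = {w | w.1 ⟨u, hu⟩ ≠ 0} := by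
      ext w
      simp [openStar, cell, hu]
    rw [h]
    exact isOpen_ne_fun ((continuous_apply _).comp continuous_subtype_val) continuous_const
  · rw [preimage_cell_openStar_of_notMem hu]
    exact isOpen_empty

theorem continuous_of_continuous_comp_cell {Z : Type*} [TopologicalSpace Z]
    {O : Set (Realization K)} (hO : IsOpen O) {f : O → Z}
    (hf : ∀ s : K.faces, Continuous fun w : cell s ⁻¹' O => f ⟨cell s w, w.2⟩) :
    Continuous f := by
  refine continuous_def.mpr fun W hW => ?_
  rw [hO.isOpenEmbedding_subtypeVal.isOpen_iff_image_isOpen, isOpen_iff]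
  intro s
  have h_open := (hO.preimage (continuous_cell s)).isOpenMap_subtype_val _ (hW.preimage (hf s))
  convert h_open using 1
  ext w
  constructor
  · rintro ⟨⟨p, hp⟩, hpW, rfl⟩
    exact ⟨⟨w, hp⟩, hpW, rfl⟩
  · rintro ⟨⟨w, hw⟩, hwW, rfl⟩
    exact ⟨⟨cell s w, hw⟩, hwW, rfl⟩

theorem exists_carries_vertex {u : V} {p : Realization K} (hp : p ∈ openStar K u) :
    ∃ s, Carries K s p (vertex K u) := by
  obtain ⟨s, hs, hps⟩ := p.exists_face_of_apply_ne_zero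
  exact ⟨s, hs, fun v => not_imp_comm.mp (hps v),
    fun v hv => vertex_apply_ne fun h => hv (h ▸ hps u hp)⟩

/- The weak topology need not be compatible with the product by the interval, so the contraction of
the open star is shown to be continuous in its curried form. -/
theorem continuous_line_vertex (u : V) :
    Continuous fun p : openStar K u => (line (exists_carries_vertex p.2)).toContinuousMap := by
  refine continuous_of_continuous_comp_cell (isOpen_openStar u) fun s => ?_
  by_cases hu : u ∈ (s : Finset V)
  · let e : stdSimplex ℝ (s : Finset V) :=
      coords (vertex K u) fun v hv => vertex_apply_ne (ne_of_mem_of_not_mem hu hv).symm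
    let G : C(stdSimplex ℝ (s : Finset V) × I, Realization K) :=
      ⟨fun x => cell s (stdSimplexSegment (x.1, e, x.2)),
        (continuous_cell s).comp (stdSimplexSegment.continuous.comp (by fun_prop))⟩
    refine (G.curry.continuous.comp continuous_subtype_val).congr fun w => ?_
    refine ContinuousMap.ext fun t => Subtype.ext (funext fun v => ?_)
    refine (cell_stdSimplexSegment s w e t v).trans (Eq.trans ?_ (line_apply _ t v).symm)
    rw [cell_coords]
  · have : IsEmpty (cell s ⁻¹' openStar K u) :=
      Set.isEmpty_coe_sort.mpr (preimage_cell_openStar_of_notMem hu)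
    exact continuous_of_const fun w => isEmptyElim w

theorem apply_of_range_subset_openStar {Q : Type*} [Group Q] (F : PathHom (Realization K) Q)
    {u : V} {p q : Realization K} (γ : Path p q) (hγ : Set.range γ ⊆ openStar K u)
    (hp : p ∈ openStar K u) (hq : q ∈ openStar K u) :
    F γ = (F (line (exists_carries_vertex hq)))⁻¹ * F (line (exists_carries_vertex hp)) := by
  let Γ : C(I, openStar K u) := ⟨fun t => ⟨γ t, hγ ⟨t, rfl⟩⟩, by fun_prop⟩
  let H : C(I × I, Realization K) :=
    (ContinuousMap.comp ⟨_, continuous_line_vertex u⟩ Γ).uncurry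
  have hH : ∀ s t v, (H (s, t)).1 v = (1 - (t : ℝ)) * (γ s).1 v + t * (vertex K u).1 v :=
    fun s t v => line_apply (exists_carries_vertex (hγ ⟨s, rfl⟩)) t v
  have h := F.mul_eq_mul_of_square H γ (line (exists_carries_vertex hp))
    (line (exists_carries_vertex hq)) (Path.refl _)
    (fun t => Subtype.ext (funext fun v => by rw [hH]; simp))
    (fun t => Subtype.ext (funext fun v => by rw [hH, line_apply, γ.source]))
    (fun t => Subtype.ext (funext fun v => by rw [hH, line_apply, γ.target]))
    (fun t => Subtype.ext (funext fun v => by rw [hH]; simp))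
  rw [PathHom.refl_apply, one_mul] at h
  rw [← h, inv_mul_cancel_left]

theorem line_mem_openStar_of_lt_one {p q : Realization K} (h : ∃ s, Carries K s p q) {u : V}
    (hp : p ∈ openStar K u) {t : I} (ht : (t : ℝ) < 1) : line h t ∈ openStar K u := by
  refine ne_of_gt ?_
  rw [line_apply]
  exact add_pos_of_pos_of_nonneg (mul_pos (sub_pos.mpr ht) ((p.2.1 u).lt_of_ne' hp))
    (mul_nonneg t.2.1 (q.2.1 u))

theorem line_mem_openStar_of_pos {p q : Realization K} (h : ∃ s, Carries K s p q) {u : V}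
    (hq : q ∈ openStar K u) {t : I} (ht : 0 < (t : ℝ)) : line h t ∈ openStar K u := by
  refine ne_of_gt ?_
  rw [line_apply]
  exact add_pos_of_nonneg_of_pos (mul_nonneg (sub_nonneg.mpr t.2.2) (p.2.1 u))
    (mul_pos ht ((q.2.1 u).lt_of_ne' hq))

theorem vertex_mem_openStar (x : V) : vertex K x ∈ openStar K x :=
  (vertex_apply_self x).trans_ne one_ne_zero

/-- A vertex of the carrier of `p`. -/
def supportVertex (p : Realization K) : V := (exists_ne_zero p).choose

theorem mem_openStar_supportVertex (p : Realization K) : p ∈ openStar K p.supportVertex :=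
  (exists_ne_zero p).choose_spec

theorem supportVertex_vertex (x : V) : (vertex K x).supportVertex = x := by
  by_contra h
  exact mem_openStar_supportVertex _ (vertex_apply_ne h)

end OpenStar

section EdgeCocycle

variable {Q : Type*} [Group Q]

/-- The cocycle identity on the triangles of `K`, including the degenerate ones. -/
def IsEdgeCocycle (K : AbstractSimplicialComplex V) (e : V → V → Q) : Prop :=
  ∀ s ∈ K.faces, ∀ x ∈ s, ∀ y ∈ s, ∀ z ∈ s, e y z * e x y = e x z

theorem isEdgeCocycle_edgeValue (F : PathHom (Realization K) Q) :
    IsEdgeCocycle K (edgeValue F) := by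
  intro s hs x hx y hy z hz
  rw [edgeValue_eq_apply_line F hs hx hy, edgeValue_eq_apply_line F hs hy hz,
    edgeValue_eq_apply_line F hs hx hz]
  exact apply_line_mul_apply_line F (carries_vertex_vertex hs hx hy)
    (carries_vertex_vertex hs hy hz)

namespace IsEdgeCocycle

variable {e : V → V → Q} (he : IsEdgeCocycle K e)
include he

theorem self_eq_one (x : V) : e x x = 1 := by
  have hx := Finset.mem_singleton_self x
  exact left_eq_mul.mp (he {x} (K.singleton_mem x) x hx x hx x hx).symm

theorem inv_eq {s : Finset V} (hs : s ∈ K.faces) {x y : V} (hx : x ∈ s) (hy : y ∈ s) :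
    (e x y)⁻¹ = e y x :=
  inv_eq_of_mul_eq_one_left ((he s hs x hx y hy x hx).trans (he.self_eq_one x))

theorem mul_eq_mul_of_mem_openStar {p q : Realization K} {u w : V}
    (hpu : p ∈ openStar K u) (hpw : p ∈ openStar K w)
    (hqu : q ∈ openStar K u) (hqw : q ∈ openStar K w) :
    e w q.supportVertex * e p.supportVertex w = e u q.supportVertex * e p.supportVertex u := by
  obtain ⟨s, hs, hps⟩ := p.exists_face_of_apply_ne_zero
  obtain ⟨t, ht, hqt⟩ := q.exists_face_of_apply_ne_zero
  rw [← he t ht w (hqt w hqw) u (hqt u hqu) _ (hqt _ q.mem_openStar_supportVertex), mul_assoc,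
    he s hs _ (hps _ p.mem_openStar_supportVertex) w (hps w hpw) u (hps u hpu)]

theorem exists_pathHom_openStar :
    ∃ F : PathHom (Realization K) Q, ∀ (u : V) {p q : Realization K} (γ : Path p q),
      Set.range γ ⊆ openStar K u → F γ = e u q.supportVertex * e p.supportVertex u := by
  classical
  let c : Realization K → Realization K → Q := fun p q =>
    if h : ∃ u, p ∈ openStar K u ∧ q ∈ openStar K u then
      e h.choose q.supportVertex * e p.supportVertex h.choose else 1
  have c_eq : ∀ {u : V} {p q : Realization K}, p ∈ openStar K u → q ∈ openStar K u →
      c p q = e u q.supportVertex * e p.supportVertex u := by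
    intro u p q hp hq
    have h : ∃ u, p ∈ openStar K u ∧ q ∈ openStar K u := ⟨u, hp, hq⟩
    exact (dif_pos h).trans
      (he.mul_eq_mul_of_mem_openStar hp h.choose_spec.1 hq h.choose_spec.2)
  have isLocalCocycle : IsLocalCocycle (Set.range (openStar K)) c := by
    refine ⟨Set.forall_mem_range.mpr isOpen_openStar,
      fun p => ⟨_, ⟨_, rfl⟩, p.mem_openStar_supportVertex⟩, ?_⟩
    rintro _ ⟨u, rfl⟩ p hp q hq w hw
    obtain ⟨s, hs, hqs⟩ := q.exists_face_of_apply_ne_zero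
    rw [c_eq hp hq, c_eq hq hw, c_eq hp hw,
      ← he.inv_eq hs (hqs u hq) (hqs _ q.mem_openStar_supportVertex)]
    group
  obtain ⟨F, hF⟩ := isLocalCocycle.exists_pathHom
  exact ⟨F, fun u p q γ hγ => (hF _ ⟨u, rfl⟩ γ hγ).trans
    (c_eq (hγ ⟨0, γ.source⟩) (hγ ⟨1, γ.target⟩))⟩

theorem exists_pathHom : ∃ F : PathHom (Realization K) Q, ∀ s ∈ K.faces, ∀ x ∈ s, ∀ y ∈ s,
    edgeValue F x y = e x y := by
  obtain ⟨F, hF⟩ := he.exists_pathHom_openStar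
  refine ⟨F, fun s hs x hx y hy => ?_⟩
  rw [edgeValue_eq_apply_line F hs hx hy]
  let ℓ := line ⟨s, carries_vertex_vertex hs hx hy⟩
  let m : I := ⟨1 / 2, by norm_num, by norm_num⟩
  have first_half : Set.range (ℓ.subpath 0 m) ⊆ openStar K x := by
    rw [Path.range_subpath_of_le _ _ _ m.2.1]
    rintro _ ⟨t, ht, rfl⟩
    exact line_mem_openStar_of_lt_one _ (vertex_mem_openStar x)
      ((show (t : ℝ) ≤ 1 / 2 from ht.2).trans_lt one_half_lt_one)
  have second_half : Set.range (ℓ.subpath m 1) ⊆ openStar K y := by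
    rw [Path.range_subpath_of_le _ _ _ m.2.2]
    rintro _ ⟨t, ht, rfl⟩
    exact line_mem_openStar_of_pos _ (vertex_mem_openStar y)
      (one_half_pos.trans_le (show 1 / 2 ≤ (t : ℝ) from ht.1))
  have supportVertex_mem : (ℓ m).supportVertex ∈ s := by
    by_contra h
    refine (ℓ m).mem_openStar_supportVertex ?_
    rw [line_apply, vertex_apply_ne (ne_of_mem_of_not_mem hx h).symm,
      vertex_apply_ne (ne_of_mem_of_not_mem hy h).symm, mul_zero, mul_zero, add_zero]
  calc F ℓ = F (ℓ.subpath m 1) * F (ℓ.subpath 0 m) := by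
        rw [F.subpath_mul_subpath, F.subpath_zero_one]
    _ = e (ℓ m).supportVertex y * e x (ℓ m).supportVertex := by
        rw [hF x _ first_half, hF y _ second_half, ℓ.source, ℓ.target, supportVertex_vertex,
          supportVertex_vertex, he.self_eq_one, he.self_eq_one, one_mul, mul_one]
    _ = e x y := he s hs x hx _ supportVertex_mem y hy

end IsEdgeCocycle

variable (F : PathHom (Realization K) Q)

theorem edgeValue_mul_apply_line {p : Realization K} {u v : V} (hu : p ∈ openStar K u)
    (hv : p ∈ openStar K v) :
    edgeValue F v u * F (line (exists_carries_vertex hv)) =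
      F (line (exists_carries_vertex hu)) := by
  obtain ⟨s, hs, hps⟩ := p.exists_face_of_apply_ne_zero
  rw [edgeValue_eq_apply_line F hs (hps v hv) (hps u hu)]
  have hvu := carries_vertex_vertex hs (hps v hv) (hps u hu)
  exact apply_line_mul_apply_line F ⟨hs, fun w => not_imp_comm.mp (hps w), hvu.2.1⟩ hvu

theorem apply_line_supportVertex_vertex (x : V) :
    F (line (exists_carries_vertex (vertex K x).mem_openStar_supportVertex)) = 1 := by
  rw [← F.refl_apply (vertex K x)]
  refine F.congr _ _ fun t => Subtype.ext (funext fun v => ?_)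
  rw [line_apply, supportVertex_vertex, Path.refl_apply]
  ring

theorem exists_conjBy_of_edgeValue_eq_conj (F' : PathHom (Realization K) Q) (b : V → Q)
    (hb : ∀ s ∈ K.faces, ∀ x ∈ s, ∀ y ∈ s,
      edgeValue F x y = b y * edgeValue F' x y * (b x)⁻¹) :
    ∃ B : Realization K → Q, (∀ x, B (vertex K x) = b x) ∧ F.ConjBy F' B := by
  let toVertex : ∀ p : Realization K, Path p (vertex K p.supportVertex) := fun p =>
    line (exists_carries_vertex p.mem_openStar_supportVertex)
  let B : Realization K → Q := fun p =>
    (F (toVertex p))⁻¹ * b p.supportVertex * F' (toVertex p)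
  refine ⟨B, fun x => ?_,
    fun _ _ γ => F.eq_conj_of_locally_eq_conj F' B γ (𝒰 := Set.range (openStar K))
      (Set.forall_mem_range.mpr isOpen_openStar)
      (fun t => ⟨_, ⟨_, rfl⟩, (γ t).mem_openStar_supportVertex⟩) ?_⟩
  · simp only [B, toVertex]
    rw [apply_line_supportVertex_vertex, apply_line_supportVertex_vertex, supportVertex_vertex,
      inv_one, one_mul, mul_one]
  rintro s t _ ⟨u, rfl⟩ hst
  have hs : γ s ∈ openStar K u := hst ⟨0, (γ.subpath s t).source⟩
  have ht : γ t ∈ openStar K u := hst ⟨1, (γ.subpath s t).target⟩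
  obtain ⟨S, hS, hsS⟩ := (γ s).exists_face_of_apply_ne_zero
  obtain ⟨T, hT, htT⟩ := (γ t).exists_face_of_apply_ne_zero
  have hbs := hb S hS _ (hsS _ (γ s).mem_openStar_supportVertex) u (hsS u hs)
  have hbt := hb T hT _ (htT _ (γ t).mem_openStar_supportVertex) u (htT u ht)
  rw [apply_of_range_subset_openStar F _ hst hs ht, apply_of_range_subset_openStar F' _ hst hs ht]
  simp only [← edgeValue_mul_apply_line F hs (γ s).mem_openStar_supportVertex,
    ← edgeValue_mul_apply_line F ht (γ t).mem_openStar_supportVertex,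
    ← edgeValue_mul_apply_line F' hs (γ s).mem_openStar_supportVertex,
    ← edgeValue_mul_apply_line F' ht (γ t).mem_openStar_supportVertex, hbs, hbt,
    B, toVertex]
  group

end EdgeCocycle

theorem pathConnectedSpace_of_joined_vertices [Nonempty V]
    (h : ∀ x y, Joined (vertex K x) (vertex K y)) : PathConnectedSpace (Realization K) := by
  have joined_vertex : ∀ p : Realization K, ∃ x, Joined p (vertex K x) := fun p => by
    obtain ⟨v, hv⟩ := p.exists_ne_zero
    exact ⟨v, ⟨line (exists_carries_vertex hv)⟩⟩
  refine ⟨⟨vertex K (Classical.arbitrary V)⟩, fun p q => ?_⟩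
  obtain ⟨x, hx⟩ := joined_vertex p
  obtain ⟨y, hy⟩ := joined_vertex q
  exact (hx.trans (h x y)).trans hy.symm

end Realization

/-! ### Geodesics and edges of the Rips complex -/

namespace IsGeodesicSpace

variable {X : Type u} [MetricSpace X] (hX : IsGeodesicSpace X)
include hX

theorem exists_path (x y : X) :
    ∃ γ : Path x y, ∀ t : I, dist x (γ t) = t * dist x y ∧ dist (γ t) y = (1 - t) * dist x y := by
  obtain ⟨γ, hγ, γ_zero, γ_one⟩ := hX x y
  have hd : (0 : ℝ) ≤ dist x y := dist_nonneg
  have hmem : ∀ t : I, (t : ℝ) * dist x y ∈ Set.Icc (0 : ℝ) (dist x y) := fun t =>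
    ⟨mul_nonneg t.2.1 hd, mul_le_of_le_one_left hd t.2.2⟩
  refine ⟨⟨⟨fun t => γ ⟨t * dist x y, hmem t⟩, hγ.continuous.comp (by fun_prop)⟩, ?_, ?_⟩,
    fun t => ⟨?_, ?_⟩⟩
  · simpa using γ_zero
  · simpa using γ_one
  · nth_rw 1 [← γ_zero]
    refine (hγ.dist_eq _ _).trans ?_
    rw [Subtype.dist_eq, dist_comm, Real.dist_eq, sub_zero, abs_of_nonneg (hmem t).1]
  · refine (congrArg₂ dist rfl γ_one.symm).trans ((hγ.dist_eq _ _).trans ?_)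
    rw [Subtype.dist_eq, dist_comm, Real.dist_eq, abs_of_nonneg (sub_nonneg.mpr (hmem t).2)]
    ring

theorem pathConnectedSpace (x₀ : X) : PathConnectedSpace X :=
  ⟨⟨x₀⟩, fun x y => ⟨(hX.exists_path x y).choose⟩⟩

/-- A choice of a geodesic from `x` to `y`, parametrized proportionally to arc length. -/
def path (x y : X) : Path x y := (hX.exists_path x y).choose

theorem dist_path_left (x y : X) (t : I) : dist x (hX.path x y t) = t * dist x y :=
  ((hX.exists_path x y).choose_spec t).1

theorem dist_path_right (x y : X) (t : I) : dist (hX.path x y t) y = (1 - t) * dist x y :=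
  ((hX.exists_path x y).choose_spec t).2

theorem dist_path_add_dist_path (x y : X) (t : I) :
    dist x (hX.path x y t) + dist (hX.path x y t) y = dist x y := by
  rw [hX.dist_path_left, hX.dist_path_right]
  ring

theorem diam_range_path_le (x y : X) : Metric.diam (Set.range (hX.path x y)) ≤ dist x y := by
  refine Metric.diam_le_of_forall_dist_le dist_nonneg ?_
  rintro _ ⟨s, rfl⟩ _ ⟨t, rfl⟩
  have hs := hX.dist_path_add_dist_path x y s
  have ht := hX.dist_path_add_dist_path x y t
  have via_left := dist_triangle_left (hX.path x y s) (hX.path x y t) x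
  have via_right := dist_triangle_right (hX.path x y s) (hX.path x y t) y
  linarith

end IsGeodesicSpace

section RipsEdges

variable {X : Type u} [MetricSpace X] {r : ℝ} {hr : 0 < r}

theorem mem_rips_iff {s : Finset X} :
    s ∈ (rips X r hr).faces ↔ s.Nonempty ∧ ∀ x ∈ s, ∀ y ∈ s, dist x y < r := by
  refine ⟨fun h => ⟨h.1, fun x hx y hy => (Metric.dist_le_diam_of_mem
    (Finset.finite_toSet s).isBounded hx hy).trans_lt h.2⟩, fun h => ⟨h.1, ?_⟩⟩
  obtain ⟨⟨a, b⟩, hab, hmax⟩ := Finset.exists_max_image (s ×ˢ s) (fun p => dist p.1 p.2)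
    (h.1.product h.1)
  rw [Finset.mem_product] at hab
  exact (Metric.diam_le_of_forall_dist_le dist_nonneg fun x hx y hy =>
    hmax (x, y) (Finset.mem_product.mpr ⟨hx, hy⟩)).trans_lt (h.2 a hab.1 b hab.2)

theorem exists_mem_rips_of_dist_lt (hr : 0 < r) {x y z : X} (hxy : dist x y < r)
    (hyz : dist y z < r) (hxz : dist x z < r) :
    ∃ s ∈ (rips X r hr).faces, x ∈ s ∧ y ∈ s ∧ z ∈ s := by
  classical
  refine ⟨{x, y, z}, mem_rips_iff.mpr ⟨Finset.insert_nonempty _ _, ?_⟩, by simp, by simp, by simp⟩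
  simp only [Finset.mem_insert, Finset.mem_singleton]
  rintro a (rfl | rfl | rfl) b (rfl | rfl | rfl) <;>
    first | (rw [dist_self]; exact hr) | assumption | (rw [dist_comm]; assumption)

variable {Q : Type*} [Group Q] (F : PathHom (Rips X r hr) Q)

theorem edgeValue_mul_of_dist_lt {x y z : X} (hxy : dist x y < r) (hyz : dist y z < r)
    (hxz : dist x z < r) :
    Realization.edgeValue F y z * Realization.edgeValue F x y = Realization.edgeValue F x z := by
  obtain ⟨s, hs, hx, hy, hz⟩ := exists_mem_rips_of_dist_lt hr hxy hyz hxz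
  exact Realization.isEdgeCocycle_edgeValue F s hs x hx y hy z hz

end RipsEdges

/-! ### From the Rips complex to the space -/

section SampleHom

variable {X : Type u} [MetricSpace X] {Q : Type*} [Group Q]

theorem dist_le_diam_range {x y : X} (γ : Path x y) (s t : I) :
    dist (γ s) (γ t) ≤ Metric.diam (Set.range γ) :=
  Metric.dist_le_diam_of_mem (isCompact_range γ.continuous).isBounded ⟨s, rfl⟩ ⟨t, rfl⟩

theorem dist_endpoints_le_diam_range {x y : X} (γ : Path x y) :
    dist x y ≤ Metric.diam (Set.range γ) := by
  simpa only [Path.source, Path.target] using dist_le_diam_range γ 0 1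

theorem PathHom.eq_conj_of_eq_conj_of_diam_lt (F F' : PathHom X Q) (b : X → Q) {ε : ℝ}
    (hε : 0 < ε) {x y : X} (γ : Path x y)
    (h : ∀ s t : I, Metric.diam (Set.range (γ.subpath s t)) < ε →
      F (γ.subpath s t) = b (γ t) * F' (γ.subpath s t) * (b (γ s))⁻¹) :
    F γ = b y * F' γ * (b x)⁻¹ := by
  refine F.eq_conj_of_locally_eq_conj F' b γ (𝒰 := Set.range fun p => Metric.ball p (ε / 3))
    (Set.forall_mem_range.mpr fun _ => Metric.isOpen_ball)
    (fun t => ⟨_, ⟨γ t, rfl⟩, Metric.mem_ball_self (by positivity)⟩) ?_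
  rintro s t _ ⟨p, rfl⟩ hst
  refine h s t ?_
  calc Metric.diam (Set.range (γ.subpath s t)) ≤ Metric.diam (Metric.ball p (ε / 3)) :=
        Metric.diam_mono hst Metric.isBounded_ball
    _ ≤ 2 * (ε / 3) := Metric.diam_ball (by positivity)
    _ < ε := by linarith

/-- A path homomorphism which is trivial on the loops contained in closed balls of radius less
than `R`, so that it factors through the quotient by the Spanier group. -/
def VanishesOnBalls (Φ : PathHom X Q) (R : ℝ) : Prop :=
  ∀ ⦃y w : X⦄ ⦃d : ℝ⦄, d < R → ∀ β : Path y y, Set.range β ⊆ Metric.closedBall w d → Φ β = 1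

variable {r : ℝ} {hr : 0 < r} {F : PathHom (Rips X r hr) Q}

variable (F) in
/-- `Φ` is the path homomorphism on `X` obtained from the path homomorphism `F` on the Rips complex
by sampling: `Φ γ` is the product of the values of `F` on the edges of the `r`-samples of `γ`. It is
enough to require this for short paths. -/
def IsSampleHom (Φ : PathHom X Q) : Prop :=
  ∀ ⦃x y : X⦄ (γ : Path x y), Metric.diam (Set.range γ) < r → Φ γ = Realization.edgeValue F x y

variable (F) in
theorem exists_isSampleHom : ∃ Φ : PathHom X Q, IsSampleHom F Φ := by
  let 𝒰 : Set (Set X) := {U | IsOpen U ∧ ∀ x ∈ U, ∀ y ∈ U, dist x y < r}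
  have isLocalCocycle : IsLocalCocycle 𝒰 (Realization.edgeValue F) := by
    refine ⟨fun U hU => hU.1, fun p => ⟨Metric.ball p (r / 2), ⟨Metric.isOpen_ball, ?_⟩,
      Metric.mem_ball_self (half_pos hr)⟩, fun U hU p hp q hq s hs =>
      edgeValue_mul_of_dist_lt F (hU.2 p hp q hq) (hU.2 q hq s hs) (hU.2 p hp s hs)⟩
    intro x hx y hy
    rw [Metric.mem_ball] at hx hy
    linarith [dist_triangle_right x y p]
  obtain ⟨Φ, hΦ⟩ := isLocalCocycle.exists_pathHom
  refine ⟨Φ, fun x y γ hγ => ?_⟩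
  -- A thickening of the range of `γ` belongs to `𝒰`.
  let δ := (r - Metric.diam (Set.range γ)) / 2
  have hδ : 0 < δ := half_pos (sub_pos.mpr hγ)
  refine hΦ (Metric.thickening δ (Set.range γ)) ⟨Metric.isOpen_thickening, ?_⟩ γ
    (Metric.self_subset_thickening hδ _)
  intro a ha b hb
  obtain ⟨_, ⟨s, rfl⟩, has⟩ := Metric.mem_thickening_iff.mp ha
  obtain ⟨_, ⟨t, rfl⟩, hbt⟩ := Metric.mem_thickening_iff.mp hb
  rw [dist_comm] at hbt
  calc dist a b ≤ dist a (γ s) + dist (γ s) (γ t) + dist (γ t) b := dist_triangle4 ..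
    _ < δ + Metric.diam (Set.range γ) + δ := by linarith [dist_le_diam_range γ s t]
    _ = r := by simp only [δ]; ring

variable (F) in
theorem edgeValue_mul_of_fan {w a b p q : X} (hwa : dist w a < r) (hwb : dist w b < r)
    (hab : dist a b < r) (hap : dist a p < r) (haq : dist a q < r) (hbq : dist b q < r)
    (hpq : dist p q < r) :
    Realization.edgeValue F p q * (Realization.edgeValue F a p * Realization.edgeValue F w a) =
      Realization.edgeValue F b q * Realization.edgeValue F w b := by
  rw [← mul_assoc, edgeValue_mul_of_dist_lt F hap hpq haq,
    ← edgeValue_mul_of_dist_lt F hab hbq haq, mul_assoc, edgeValue_mul_of_dist_lt F hwa hab hwb]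

/- Over a ball of radius `d < 3r/2` with center `w`, the cocycle is trivialized by the edge paths
from `w` to `p` through the point at two thirds of a geodesic, whose edges have length at most
`2d/3 < r` and `d/3`. -/
theorem IsSampleHom.vanishesOnBalls (hX : IsGeodesicSpace X) {Φ : PathHom X Q}
    (hΦ : IsSampleHom F Φ) : VanishesOnBalls Φ (3 * r / 2) := by
  intro y w d hd β hβ
  let c : X → X := fun p => hX.path w p ⟨2 / 3, by norm_num, by norm_num⟩
  let b : X → Q := fun p => Realization.edgeValue F (c p) p * Realization.edgeValue F w (c p)
  have hd_nonneg : 0 ≤ d := dist_nonneg.trans (Metric.mem_closedBall.mp (hβ ⟨0, rfl⟩))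
  have dist_w_c : ∀ t, dist w (c (β t)) ≤ 2 * d / 3 := fun t => by
    have ht := Metric.mem_closedBall'.mp (hβ ⟨t, rfl⟩)
    simp only [c, hX.dist_path_left]
    linarith
  have dist_c : ∀ t, dist (c (β t)) (β t) ≤ d / 3 := fun t => by
    have ht := Metric.mem_closedBall'.mp (hβ ⟨t, rfl⟩)
    simp only [c, hX.dist_path_right]
    linarith
  have coboundary : Φ β = b y * (1 : PathHom X Q) β * (b y)⁻¹ := by
    refine Φ.eq_conj_of_eq_conj_of_diam_lt 1 b (ε := r - 2 * d / 3) (by linarith) β ?_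
    intro s t hst
    have h_short := (dist_endpoints_le_diam_range (β.subpath s t)).trans_lt hst
    have dist_c_t := dist_triangle (c (β s)) (β s) (β t)
    have dist_c_c := dist_triangle4_right (c (β s)) (c (β t)) (β s) (β t)
    rw [hΦ _ (hst.trans_le (by linarith)), PathHom.one_apply, mul_one]
    refine eq_mul_inv_of_mul_eq (edgeValue_mul_of_fan F ?_ ?_ ?_ ?_ ?_ ?_ ?_) <;>
      linarith [dist_w_c s, dist_w_c t, dist_c s, dist_c t]
  rw [coboundary, PathHom.one_apply, mul_one, mul_inv_cancel]

end SampleHom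

/-! ### From the space to the Rips complex -/

section GeodesicHom

variable {X : Type u} [MetricSpace X] (hX : IsGeodesicSpace X) {Q : Type*} [Group Q] {r : ℝ}
  {Φ : PathHom X Q}

/- A geodesic triangle of perimeter `2d` lies in the closed ball of radius `d` around any of its
vertices. -/
theorem VanishesOnBalls.isEdgeCocycle (hr : 0 < r) (hΦ : VanishesOnBalls Φ (3 * r / 2)) :
    Realization.IsEdgeCocycle (rips X r hr) fun x y => Φ (hX.path x y) := by
  intro s hs x hx y hy z hz
  have dist_lt := (mem_rips_iff.mp hs).2
  have loop_eq_one := hΦ (w := x) (d := (dist x y + dist y z + dist x z) / 2)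
    (by linarith [dist_lt x hx y hy, dist_lt y hy z hz, dist_lt x hx z hz])
    (((hX.path x y).trans (hX.path y z)).trans (hX.path x z).symm) ?_
  · rw [PathHom.trans_apply, PathHom.trans_apply, PathHom.symm_apply, inv_mul_eq_one] at loop_eq_one
    exact loop_eq_one.symm
  rw [Path.trans_range, Path.trans_range, Path.symm_range]
  rintro _ ((⟨t, rfl⟩ | ⟨t, rfl⟩) | ⟨t, rfl⟩) <;> rw [Metric.mem_closedBall']
  · have h_sum := hX.dist_path_add_dist_path x y t
    linarith [dist_triangle_right x y z, dist_nonneg (x := hX.path x y t) (y := y)]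
  · have h_sum := hX.dist_path_add_dist_path y z t
    linarith [dist_triangle x y (hX.path y z t), dist_triangle_right x (hX.path y z t) z]
  · have h_sum := hX.dist_path_add_dist_path x z t
    linarith [dist_triangle x y z, dist_nonneg (x := hX.path x z t) (y := z)]

theorem VanishesOnBalls.apply_eq_apply_path (hΦ : VanishesOnBalls Φ (3 * r / 2)) {x y : X}
    (γ : Path x y) (hγ : Metric.diam (Set.range γ) < r) : Φ γ = Φ (hX.path x y) := by
  have diam_nonneg := Metric.diam_nonneg (s := Set.range γ)
  have loop_eq_one := hΦ (w := x) (d := Metric.diam (Set.range γ)) (by linarith)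
    (γ.trans (hX.path x y).symm) ?_
  · rw [PathHom.trans_apply, PathHom.symm_apply, inv_mul_eq_one] at loop_eq_one
    exact loop_eq_one.symm
  rw [Path.trans_range, Path.symm_range]
  rintro _ (⟨t, rfl⟩ | ⟨t, rfl⟩) <;> rw [Metric.mem_closedBall']
  · simpa only [Path.source] using dist_le_diam_range γ 0 t
  · have h_sum := hX.dist_path_add_dist_path x y t
    linarith [dist_endpoints_le_diam_range γ, dist_nonneg (x := hX.path x y t) (y := y)]

theorem IsSampleHom.apply_path {hr : 0 < r} {F : PathHom (Rips X r hr) Q}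
    (hΦ : IsSampleHom F Φ) {x y : X} (h : dist x y < r) :
    Φ (hX.path x y) = Realization.edgeValue F x y :=
  hΦ _ ((hX.diam_range_path_le x y).trans_lt h)

include hX in
theorem VanishesOnBalls.exists_isSampleHom (hr : 0 < r) (hΦ : VanishesOnBalls Φ (3 * r / 2)) :
    ∃ F : PathHom (Rips X r hr) Q, IsSampleHom F Φ := by
  obtain ⟨F, hF⟩ := (hΦ.isEdgeCocycle hX hr).exists_pathHom
  refine ⟨F, fun x y γ hγ => ?_⟩
  have hxy := (dist_endpoints_le_diam_range γ).trans_lt hγ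
  obtain ⟨s, hs, hx, hy, -⟩ := exists_mem_rips_of_dist_lt hr hxy (by rwa [dist_self]) hxy
  rw [hΦ.apply_eq_apply_path hX γ hγ, hF s hs x hx y hy]

end GeodesicHom

section Functoriality

variable {X : Type u} [MetricSpace X] {Q : Type*} [Group Q] {r : ℝ} {hr : 0 < r}
  {F F' : PathHom (Rips X r hr) Q} {Φ Φ' : PathHom X Q}

theorem IsSampleHom.comp (hΦ : IsSampleHom F Φ) {R : Type*} [Group R] (f : Q →* R) :
    IsSampleHom (F.comp f) (Φ.comp f) := by
  intro x y γ hγ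
  rw [Realization.edgeValue_comp]
  exact congrArg f (hΦ γ hγ)

theorem IsSampleHom.exists_conjBy (hX : IsGeodesicSpace X) (hΦ : IsSampleHom F Φ)
    (hΦ' : IsSampleHom F' Φ') {b : X → Q} (h : Φ.ConjBy Φ' b) :
    ∃ B : Rips X r hr → Q, (∀ x, B (Realization.vertex _ x) = b x) ∧ F.ConjBy F' B := by
  refine Realization.exists_conjBy_of_edgeValue_eq_conj F F' b fun s hs x hx y hy => ?_
  have hxy := (mem_rips_iff.mp hs).2 x hx y hy
  rw [← hΦ.apply_path hX hxy, ← hΦ'.apply_path hX hxy, h]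

theorem IsSampleHom.apply_eq_of_loops_eq (hX : IsGeodesicSpace X) (hΦ : IsSampleHom F Φ)
    (hΦ' : IsSampleHom F' Φ') {x₀ : X} (h : ∀ α : Path x₀ x₀, Φ α = Φ' α)
    (γ : Path (Realization.vertex (rips X r hr) x₀) (Realization.vertex _ x₀)) : F γ = F' γ := by
  have := hX.pathConnectedSpace x₀
  obtain ⟨b, hb, hΦΦ'⟩ := PathHom.exists_conjBy_of_loops_eq x₀ h
  obtain ⟨B, hB, hFF'⟩ := hΦ.exists_conjBy hX hΦ' hΦΦ'
  exact hFF'.apply_eq_of_eq_one ((hB x₀).trans hb) γ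

end Functoriality

/-! ### Samples of loops -/

section Samples

variable {X : Type u} [MetricSpace X] {r : ℝ} {x : X} {α : Path x x}

theorem Sample.diam_range_subpath_lt (s : Sample α r) (i : Fin s.m) :
    Metric.diam (Set.range (α.subpath (s.t i.castSucc) (s.t i.succ))) < r := by
  rw [Path.range_subpath_of_le _ _ _ (s.strictMono.monotone i.castSucc_lt_succ.le)]
  exact s.diam_lt i

variable {hr : 0 < r} {Q : Type*} [Group Q] {F : PathHom (Rips X r hr) Q} {Φ : PathHom X Q}

open Classical in
theorem IsSampleHom.edgePath_apply (hΦ : IsSampleHom F Φ) {x y : X} (α : Path x y) {n : ℕ}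
    (t : Fin (n + 1) → I)
    (ht : ∀ i : Fin n, Metric.diam (Set.range (α.subpath (t i.castSucc) (t i.succ))) < r)
    (h : ∀ i : Fin n, ({α (t i.castSucc), α (t i.succ)} : Finset X) ∈ (rips X r hr).faces) :
    F (Realization.edgePath (rips X r hr) (fun i => α (t i)) h) =
      Φ (α.subpath (t 0) (t (Fin.last n))) := by
  induction n with
  | zero =>
    refine (F.refl_apply _).trans (Eq.trans ?_ (congrArg Φ.toFun (Path.subpath_self α (t 0))).symm)
    exact (Φ.refl_apply _).symm
  | succ n ih =>
    have h_edge := (Realization.apply_edge F (h (Fin.last n))).trans (hΦ _ (ht (Fin.last n))).symm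
    have h_path := ih (fun i => t i.castSucc) (fun i => ht i.castSucc) fun i => h i.castSucc
    rw [← Φ.subpath_mul_subpath α (t 0) (t (Fin.last n).castSucc)]
    exact (F.trans_apply _ _).trans (congrArg₂ (· * ·) h_edge h_path)

theorem IsSampleHom.edgeValue_last_zero (hΦ : IsSampleHom F Φ) (s : Sample α r) :
    Realization.edgeValue F (α (s.t (Fin.last s.m))) (α (s.t 0)) =
      Φ (α.subpath 0 (s.t 0)) * Φ (α.subpath (s.t (Fin.last s.m)) 1) := by
  let toEnd : Path (α (s.t (Fin.last s.m))) x :=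
    (α.subpath (s.t (Fin.last s.m)) 1).cast rfl α.target.symm
  let fromStart : Path x (α (s.t 0)) := (α.subpath 0 (s.t 0)).cast α.source.symm rfl
  have range_toEnd : Set.range toEnd = α '' Set.Icc (s.t (Fin.last s.m)) 1 :=
    Path.range_subpath_of_le _ _ _ (s.t _).2.2
  have range_fromStart : Set.range fromStart = α '' Set.Icc 0 (s.t 0) :=
    Path.range_subpath_of_le _ _ _ (s.t _).2.1
  have h_diam : Metric.diam (Set.range (toEnd.trans fromStart)) < r := by
    rw [Path.trans_range, range_toEnd, range_fromStart, Set.union_comm, ← Set.image_union]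
    exact s.diam_wrap_lt
  rw [← hΦ _ h_diam, PathHom.trans_apply]
  exact congrArg₂ _ (Φ.congr _ _ fun _ => rfl) (Φ.congr _ _ fun _ => rfl)

theorem IsSampleHom.loop_apply (hΦ : IsSampleHom F Φ) (s : Sample α r) :
    F (s.loop hr) = Φ (α.subpath 0 (s.t 0)) * Φ α * (Φ (α.subpath 0 (s.t 0)))⁻¹ := by
  let a := s.t 0
  let b := s.t (Fin.last s.m)
  calc F (s.loop hr)
      = Realization.edgeValue F (α b) (α a) * Φ (α.subpath a b) :=
        (F.trans_apply _ _).trans (congrArg₂ _ (Realization.apply_edge F _)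
          (hΦ.edgePath_apply α s.t s.diam_range_subpath_lt _))
    _ = Φ (α.subpath 0 a) * (Φ (α.subpath b 1) * Φ (α.subpath a b) * Φ (α.subpath 0 a)) *
          (Φ (α.subpath 0 a))⁻¹ := by
        rw [hΦ.edgeValue_last_zero s]
        simp only [a, b]
        group
    _ = Φ (α.subpath 0 a) * Φ α * (Φ (α.subpath 0 a))⁻¹ := by
        rw [Φ.subpath_mul_subpath, Φ.subpath_mul_subpath, Φ.subpath_zero_one]

theorem IsSampleHom.basedLoop_apply (hΦ : IsSampleHom F Φ) (s : Sample α r) (hs : s.t 0 = 0) :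
    F (s.basedLoop hs hr) = Φ α := by
  have h_start : Φ (α.subpath 0 (s.t 0)) = 1 := by
    rw [hs, Path.subpath_self]
    exact Φ.refl_apply _
  calc F (s.basedLoop hs hr) = F (s.loop hr) := F.congr _ _ fun _ => rfl
    _ = Φ α := by rw [hΦ.loop_apply, h_start, one_mul, inv_one, mul_one]

theorem IsSampleHom.loop_apply_of_comm {Q : Type*} [CommGroup Q] {F : PathHom (Rips X r hr) Q}
    {Φ : PathHom X Q} (hΦ : IsSampleHom F Φ) (s : Sample α r) : F (s.loop hr) = Φ α := by
  rw [hΦ.loop_apply, mul_inv_cancel_comm]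

theorem exists_diam_image_Icc_lt (α : C(I, X)) (hr : 0 < r) :
    ∃ δ > 0, ∀ a b : I, (b : ℝ) - a < δ → Metric.diam (α '' Set.Icc a b) < r := by
  obtain ⟨δ, hδ, h⟩ := Metric.uniformContinuous_iff.mp
    (CompactSpace.uniformContinuous_of_continuous α.continuous) (r / 2) (half_pos hr)
  refine ⟨δ, hδ, fun a b hab => ?_⟩
  refine (Metric.diam_le_of_forall_dist_le (half_pos hr).le ?_).trans_lt (half_lt_self hr)
  rintro _ ⟨p, ⟨hap, hpb⟩, rfl⟩ _ ⟨q, ⟨haq, hqb⟩, rfl⟩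
  refine (h ((Real.dist_le_of_mem_Icc ?_ ?_).trans_lt hab)).le
  exacts [⟨hap, hpb⟩, ⟨haq, hqb⟩]

theorem exists_sample (α : Path x x) (hr : 0 < r) : ∃ s : Sample α r, s.t 0 = 0 := by
  obtain ⟨δ, hδ, diam_lt⟩ := exists_diam_image_Icc_lt α.toContinuousMap hr
  obtain ⟨n, hn⟩ := exists_nat_one_div_lt hδ
  have hn_pos : (0 : ℝ) < n + 1 := n.cast_add_one_pos
  let t : Fin (n + 1) → I := fun i =>
    ⟨i / (n + 1), by positivity, (div_le_one hn_pos).mpr (by exact_mod_cast i.2.le)⟩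
  have t_zero : t 0 = 0 := Subtype.ext (by simp [t])
  have strictMono : StrictMono t := fun i j hij =>
    Subtype.mk_lt_mk.mpr (div_lt_div_of_pos_right (Nat.cast_lt.mpr hij) hn_pos)
  have image_wrap : α '' (Set.Icc 0 (t 0) ∪ Set.Icc (t (Fin.last n)) 1) =
      α '' Set.Icc (t (Fin.last n)) 1 := by
    rw [Set.image_union, t_zero, Set.Icc_self, Set.image_singleton, α.source]
    refine Set.union_eq_self_of_subset_left (Set.singleton_subset_iff.mpr ?_)
    exact ⟨1, Set.right_mem_Icc.mpr (t _).2.2, α.target⟩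
  refine ⟨⟨n, t, strictMono, fun i => diam_lt _ _ ?_, image_wrap ▸ diam_lt _ _ ?_⟩, t_zero⟩
  · simp only [t, Fin.val_succ, Fin.val_castSucc, Nat.cast_add, Nat.cast_one, ← sub_div,
      add_sub_cancel_left]
    exact hn
  · simp only [t, Fin.val_last, Set.Icc.coe_one, one_sub_div hn_pos.ne', add_sub_cancel_left]
    exact hn

/-- An `r`-sample is also a sample at every larger scale. -/
def Sample.mono {q : ℝ} (hrq : r < q) (s : Sample α r) : Sample α q where
  m := s.m
  t := s.t
  strictMono := s.strictMono
  diam_lt i := (s.diam_lt i).trans hrq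
  diam_wrap_lt := s.diam_wrap_lt.trans hrq

open Classical in
theorem Realization.map_edgePath {V : Type u} {K L : AbstractSimplicialComplex V} (h : K ≤ L)
    {n : ℕ} (x : Fin (n + 1) → V)
    (hK : ∀ i : Fin n, ({x i.castSucc, x i.succ} : Finset V) ∈ K.faces) :
    (edgePath K x hK).map (incl h).continuous = edgePath L x fun i => h (hK i) := by
  induction n with
  | zero => rfl
  | succ n ih =>
    refine (Path.map_trans _ _ _).trans ?_
    exact congrArg (Path.trans · _) (ih (fun i => x i.castSucc) fun i => hK i.castSucc)

theorem Sample.map_loop {q : ℝ} (hrq : r < q) (s : Sample α r) :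
    (s.loop hr).map (bonding X hr hrq).continuous = (s.mono hrq).loop (hr.trans hrq) := by
  refine (Path.map_trans _ _ _).trans ?_
  exact congrArg (Path.trans · _) (Realization.map_edgePath (rips_mono X hr hrq) _ _)

end Samples

/-! ### The isomorphism of fundamental groups -/

section FundamentalGroupEquiv

variable {X : Type u} [MetricSpace X]

theorem IsGeodesicSpace.pathConnectedSpace_rips (hX : IsGeodesicSpace X) (x₀ : X) {r : ℝ}
    (hr : 0 < r) : PathConnectedSpace (Rips X r hr) := by
  have : Nonempty X := ⟨x₀⟩
  refine Realization.pathConnectedSpace_of_joined_vertices fun x y => ?_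
  refine path_induction_of_openCover
    (P := fun {p q} _ => Joined (Realization.vertex (rips X r hr) p) (Realization.vertex _ q))
    (fun _ h => h) (fun _ _ h h' => h.trans h') (hX.path x y)
    (𝒰 := Set.range fun p => Metric.ball p (r / 2))
    (Set.forall_mem_range.mpr fun _ => Metric.isOpen_ball)
    (fun t => ⟨_, ⟨_, rfl⟩, Metric.mem_ball_self (half_pos hr)⟩) ?_
  rintro s t _ ⟨p, rfl⟩ hst
  have h_source := Metric.mem_ball.mp (hst ⟨0, Path.source _⟩)
  have h_target := Metric.mem_ball.mp (hst ⟨1, Path.target _⟩)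
  have h_dist : dist (hX.path x y s) (hX.path x y t) < r := by
    linarith [dist_triangle_right (hX.path x y s) (hX.path x y t) p]
  obtain ⟨u, hu, hs, ht, -⟩ := exists_mem_rips_of_dist_lt hr h_dist (by rwa [dist_self]) h_dist
  exact ⟨Realization.line ⟨u, Realization.carries_vertex_vertex hu hs ht⟩⟩

theorem exists_loopClass_eq {Y : Type u} [TopologicalSpace Y] {y : Y} (c : FundamentalGroup Y y) :
    ∃ α : Path y y, loopClass α = c :=
  Path.Homotopic.Quotient.mk_surjective c

theorem VanishesOnBalls.spanierPi_le_ker {Q : Type*} [Group Q] {Φ : PathHom X Q} {R : ℝ}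
    (hΦ : VanishesOnBalls Φ R) (x₀ : X) : spanierPi X x₀ R ≤ (Φ.toMonoidHom x₀).ker := by
  refine (Subgroup.closure_le _).mpr ?_
  rintro _ ⟨y, w, d, α, β, hd, hβ, rfl⟩
  refine MonoidHom.mem_ker.mpr ?_
  calc Φ ((α.trans β).trans α.symm) = 1 := by
        rw [Φ.trans_apply, Φ.trans_apply, hΦ hd β hβ, Φ.symm_apply, one_mul, inv_mul_cancel]

theorem vanishesOnBalls_spanierPi {x₀ : X} (C : ∀ p, Path x₀ p) (R : ℝ) :
    VanishesOnBalls ((PathHom.ofBasePaths C).comp (QuotientGroup.mk' (spanierPi X x₀ R))) R :=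
  fun y w d hd β hβ => (QuotientGroup.eq_one_iff _).mpr
    (Subgroup.subset_closure ⟨y, w, d, C y, β, hd, hβ, rfl⟩)

theorem exists_mulEquiv_fundamentalGroup_rips (hX : IsGeodesicSpace X) (x₀ : X) {r : ℝ}
    (hr : 0 < r) :
    ∃ e : (FundamentalGroup X x₀ ⧸ spanierPi X x₀ (3 * r / 2)) ≃*
        FundamentalGroup (Rips X r hr) (Realization.vertex _ x₀),
      ∀ (α : Path x₀ x₀) (s : Sample α r) (hs : s.t 0 = 0),
        e (QuotientGroup.mk (loopClass α)) = loopClass (s.basedLoop hs hr) := by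
  have := hX.pathConnectedSpace x₀
  have := hX.pathConnectedSpace_rips x₀ hr
  obtain ⟨C, hC⟩ := exists_basePaths x₀
  obtain ⟨D, hD⟩ := exists_basePaths (Realization.vertex (rips X r hr) x₀)
  let U := (PathHom.ofBasePaths C).comp (QuotientGroup.mk' (spanierPi X x₀ (3 * r / 2)))
  let F := PathHom.ofBasePaths D
  obtain ⟨Φ, hΦ⟩ := exists_isSampleHom F
  have hU : VanishesOnBalls U (3 * r / 2) := vanishesOnBalls_spanierPi C _
  obtain ⟨Ψ, hΨ⟩ := hU.exists_isSampleHom hX hr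
  let φ := QuotientGroup.lift _ (Φ.toMonoidHom x₀) ((hΦ.vanishesOnBalls hX).spanierPi_le_ker x₀)
  let ψ := Ψ.toMonoidHom (Realization.vertex _ x₀)
  have U_loop (α : Path x₀ x₀) : U α = QuotientGroup.mk (loopClass α) :=
    congrArg _ (PathHom.ofBasePaths_loop hC α)
  have F_loop (γ : Path (Realization.vertex (rips X r hr) x₀) (Realization.vertex _ x₀)) :
      F γ = loopClass γ := PathHom.ofBasePaths_loop hD γ
  have Φ_loop (α : Path x₀ x₀) (s : Sample α r) (hs : s.t 0 = 0) :
      Φ α = loopClass (s.basedLoop hs hr) :=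
    (hΦ.basedLoop_apply s hs).symm.trans (F_loop _)
  have ψ_Φ (α : Path x₀ x₀) : ψ (Φ α) = U α := by
    obtain ⟨s, hs⟩ := exists_sample α hr
    rw [Φ_loop α s hs]
    exact hΨ.basedLoop_apply s hs
  have φ_Ψ (γ : Path (Realization.vertex (rips X r hr) x₀) (Realization.vertex _ x₀)) :
      φ (Ψ γ) = F γ :=
    (hΨ.comp φ).apply_eq_of_loops_eq hX hΦ (fun α => congrArg φ (U_loop α)) γ
  refine ⟨φ.toMulEquiv ψ ?_ ?_, Φ_loop⟩
  · refine QuotientGroup.monoidHom_ext _ (MonoidHom.ext fun c => ?_)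
    obtain ⟨α, rfl⟩ := exists_loopClass_eq c
    exact (ψ_Φ α).trans (U_loop α)
  · ext c
    obtain ⟨γ, rfl⟩ := exists_loopClass_eq c
    exact (φ_Ψ γ).trans (F_loop γ)

theorem ripsPiBonding_basedLoop (x₀ : X) {p q : ℝ} (hp : 0 < p) (hpq : p < q) {α : Path x₀ x₀}
    (s : Sample α p) (hs : s.t 0 = 0) :
    ripsPiBonding X x₀ hp hpq (loopClass (s.basedLoop hs hp)) =
      loopClass ((s.mono hpq).basedLoop hs (hp.trans hpq)) := by
  refine (FundamentalGroup.mapOfEq_apply _ _ _).trans ?_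
  refine congrArg loopClass (Path.ext (funext fun t => ?_) :
    (((s.basedLoop hs hp).map (bonding X hp hpq).continuous).cast rfl rfl) = _)
  exact DFunLike.congr_fun (s.map_loop hpq) t

end FundamentalGroupEquiv

/-! ### Singular chains of dimension at most two -/

section SingularChains

open Simplicial

variable {Y : Type u} [TopologicalSpace Y]

/-- A continuous map from the standard `n`-simplex as an `n`-simplex of the singular set. -/
def singularSimplex {n : ℕ} :
    C(stdSimplex ℝ (Fin (n + 1)), Y) ≃ (TopCat.toSSet.obj (TopCat.of Y)) _⦋n⦌ :=
  (TopCat.toSSetObjEquiv (TopCat.of Y) (.op ⦋n⦌)).symm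

/-- The `i`-th face of the standard simplex. -/
def faceMap {n : ℕ} (i : Fin (n + 2)) :
    C(stdSimplex ℝ (Fin (n + 1)), stdSimplex ℝ (Fin (n + 2))) :=
  ⟨stdSimplex.map i.succAbove, stdSimplex.continuous_map i.succAbove⟩

theorem faceMap_apply_succAbove {n : ℕ} (i : Fin (n + 2)) (w : stdSimplex ℝ (Fin (n + 1)))
    (k : Fin (n + 1)) : faceMap i w (i.succAbove k) = w k := by
  refine (FunOnFinite.linearMap_apply_apply ℝ ℝ i.succAbove w _).trans ?_
  simp only [Fin.succAbove_right_inj, Finset.filter_eq', Finset.mem_univ, if_true,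
    Finset.sum_singleton]

theorem faceMap_apply_self {n : ℕ} (i : Fin (n + 2)) (w : stdSimplex ℝ (Fin (n + 1))) :
    faceMap i w i = 0 := by
  refine (FunOnFinite.linearMap_apply_apply ℝ ℝ i.succAbove w _).trans ?_
  simp only [Fin.succAbove_ne, Finset.filter_false, Finset.sum_empty]

theorem δ_singularSimplex {n : ℕ} (f : C(stdSimplex ℝ (Fin (n + 2)), Y)) (i : Fin (n + 2)) :
    (TopCat.toSSet.obj (TopCat.of Y)).δ i (singularSimplex f) =
      singularSimplex (f.comp (faceMap i)) :=
  rfl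

/-- A map from the standard `1`-simplex as a map from the unit interval. -/
def arc : C(stdSimplex ℝ (Fin 2), Y) ≃ C(I, Y) :=
  (stdSimplexHomeomorphUnitInterval.arrowCongr (.refl Y)).toEquiv

/-- A map from the unit interval as a singular `1`-simplex. -/
def arcSimplex : C(I, Y) ≃ (TopCat.toSSet.obj (TopCat.of Y)) _⦋1⦌ :=
  arc.symm.trans singularSimplex

theorem singularSimplex_eq_arcSimplex (f : C(stdSimplex ℝ (Fin 2), Y)) :
    singularSimplex f = arcSimplex (arc f) :=
  congrArg singularSimplex (arc.symm_apply_apply f).symm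

/-- A point as a singular `0`-simplex. -/
def pointSimplex : Y ≃ (TopCat.toSSet.obj (TopCat.of Y)) _⦋0⦌ :=
  (TopCat.toSSetObj₀Equiv (X := TopCat.of Y)).symm

theorem δ_zero_arcSimplex (γ : C(I, Y)) :
    (TopCat.toSSet.obj (TopCat.of Y)).δ 0 (arcSimplex γ) = pointSimplex (γ 1) :=
  TopCat.δ_zero_toSSetObj₁Equiv.symm (TopCat.ofHom (γ.comp ⟨ULift.down, continuous_uliftDown⟩))

theorem δ_one_arcSimplex (γ : C(I, Y)) :
    (TopCat.toSSet.obj (TopCat.of Y)).δ 1 (arcSimplex γ) = pointSimplex (γ 0) :=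
  TopCat.δ_one_toSSetObj₁Equiv.symm (TopCat.ofHom (γ.comp ⟨ULift.down, continuous_uliftDown⟩))

variable (G : Type v) [AddCommGroup G]

theorem ι_singularSimplex_d (f : C(stdSimplex ℝ (Fin 3), Y)) :
    SSet.ιChainComplex _ (singularSimplex f) ≫ (singularChains Y G).d 2 1 =
      SSet.ιChainComplex _ (arcSimplex (arc (f.comp (faceMap 0)))) -
        SSet.ιChainComplex _ (arcSimplex (arc (f.comp (faceMap 1)))) +
        SSet.ιChainComplex _ (arcSimplex (arc (f.comp (faceMap 2)))) := by
  simp only [← singularSimplex_eq_arcSimplex, ← δ_singularSimplex]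
  refine ((SSet.ιChainComplex_d _ _ _).trans (Fin.sum_univ_three _)).trans ?_
  simp [sub_eq_add_neg]

theorem ι_arcSimplex_d (γ : C(I, Y)) :
    SSet.ιChainComplex _ (arcSimplex γ) ≫ (singularChains Y G).d 1 0 =
      SSet.ιChainComplex _ (pointSimplex (γ 1)) - SSet.ιChainComplex _ (pointSimplex (γ 0)) := by
  rw [← δ_zero_arcSimplex, ← δ_one_arcSimplex]
  refine ((SSet.ιChainComplex_d _ _ _).trans (Fin.sum_univ_two _)).trans ?_
  simp [sub_eq_add_neg]

/-- The class of a singular `1`-simplex modulo boundaries, as a homomorphism in the coefficient. -/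
def arcClass (γ : C(I, Y)) : AddCommGrpCat.of (ULift.{u} G) ⟶ (singularChains Y G).opcycles 1 :=
  SSet.ιChainComplex _ (arcSimplex γ) ≫ (singularChains Y G).pOpcycles 1

theorem arcClass_add_of_triangle (f : C(stdSimplex ℝ (Fin 3), Y)) :
    arcClass G (arc (f.comp (faceMap 2))) + arcClass G (arc (f.comp (faceMap 0))) =
      arcClass G (arc (f.comp (faceMap 1))) := by
  have h : (SSet.ιChainComplex _ (singularSimplex f) ≫ (singularChains Y G).d 2 1) ≫
      (singularChains Y G).pOpcycles 1 = 0 := by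
    rw [Category.assoc, HomologicalComplex.d_pOpcycles, Limits.comp_zero]
  rw [ι_singularSimplex_d, Preadditive.add_comp, Preadditive.sub_comp] at h
  rw [← sub_eq_zero, ← h]
  simp only [arcClass]
  abel

section Affine

variable {E : Type*} [AddCommGroup E] [Module ℝ E] [TopologicalSpace E] [ContinuousAdd E]
  [ContinuousSMul ℝ E]

/-- The affine map from the standard simplex with prescribed values at the vertices. -/
def affineSimplex {n : ℕ} (v : Fin (n + 1) → E) : C(stdSimplex ℝ (Fin (n + 1)), E) where
  toFun w := ∑ i, w i • v i
  continuous_toFun := continuous_finsetSum _ fun i _ =>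
    ((continuous_apply i).comp continuous_subtype_val).smul continuous_const

theorem affineSimplex_comp_faceMap {n : ℕ} (v : Fin (n + 2) → E) (i : Fin (n + 2)) :
    (affineSimplex v).comp (faceMap i) = affineSimplex (v ∘ i.succAbove) := by
  ext w
  refine (Fin.sum_univ_succAbove _ i).trans ?_
  simp only [faceMap_apply_self, zero_smul, zero_add, faceMap_apply_succAbove]
  rfl

/-- The restriction of a continuous map to the segment between two points. -/
def segmentMap (F : C(E, Y)) (a b : E) : C(I, Y) :=
  F.comp ⟨fun t => (1 - (t : ℝ)) • a + (t : ℝ) • b, by fun_prop⟩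

theorem segmentMap_apply (F : C(E, Y)) (a b : E) (t : I) :
    segmentMap F a b t = F ((1 - (t : ℝ)) • a + (t : ℝ) • b) :=
  rfl

theorem arc_comp_affineSimplex (F : C(E, Y)) (v : Fin 2 → E) :
    arc (F.comp (affineSimplex v)) = segmentMap F (v 0) (v 1) :=
  ContinuousMap.ext fun t => congrArg F
    (Fin.sum_univ_two fun i => stdSimplexHomeomorphUnitInterval.symm t i • v i)

theorem arcClass_segmentMap_add (F : C(E, Y)) (a b c : E) :
    arcClass G (segmentMap F a b) + arcClass G (segmentMap F b c) =
      arcClass G (segmentMap F a c) := by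
  have h := arcClass_add_of_triangle G (F.comp (affineSimplex ![a, b, c]))
  simp only [ContinuousMap.comp_assoc, affineSimplex_comp_faceMap, arc_comp_affineSimplex] at h
  exact h

theorem arcClass_const (y : Y) : arcClass G (ContinuousMap.const I y) = 0 :=
  left_eq_add.mp (arcClass_segmentMap_add G (ContinuousMap.const ℝ y) 0 0 0).symm

end Affine

theorem arcClass_eq_of_homotopic {p q : Y} {γ δ : Path p q} (h : γ.Homotopic δ) :
    arcClass G γ.toContinuousMap = arcClass G δ.toContinuousMap := by
  obtain ⟨H⟩ := h
  let F : C(ℝ × ℝ, Y) := (H : C(I × I, Y)).comp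
    ⟨fun w => (Set.projIcc 0 1 zero_le_one w.1, Set.projIcc 0 1 zero_le_one w.2), by fun_prop⟩
  have left_side : segmentMap F (0, 0) (0, 1) = γ.toContinuousMap := by
    ext t
    simp [segmentMap_apply, F]
  have right_side : segmentMap F (1, 0) (1, 1) = δ.toContinuousMap := by
    ext t
    simp [segmentMap_apply, F]
  have bottom_side : segmentMap F (0, 0) (1, 0) = ContinuousMap.const I p := by
    ext t
    simp [segmentMap_apply, F]
  have top_side : segmentMap F (0, 1) (1, 1) = ContinuousMap.const I q := by
    ext t
    simp [segmentMap_apply, F]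
  have upper_triangle := arcClass_segmentMap_add G F (0, 0) (0, 1) (1, 1)
  have lower_triangle := arcClass_segmentMap_add G F (0, 0) (1, 0) (1, 1)
  rw [left_side, top_side, arcClass_const, add_zero] at upper_triangle
  rw [right_side, bottom_side, arcClass_const, zero_add] at lower_triangle
  rw [upper_triangle, lower_triangle]

theorem arcClass_trans {p q s : Y} (γ : Path p q) (δ : Path q s) :
    arcClass G (γ.trans δ).toContinuousMap =
      arcClass G δ.toContinuousMap + arcClass G γ.toContinuousMap := by
  let F : C(ℝ, Y) := ⟨(γ.trans δ).extend, (γ.trans δ).continuous_extend⟩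
  have first_half : segmentMap F 0 (1 / 2) = γ.toContinuousMap := by
    ext t
    calc segmentMap F 0 (1 / 2) t = (γ.trans δ).extend (t / 2) :=
          congrArg (γ.trans δ).extend
            (show (1 - (t : ℝ)) * 0 + t * (1 / 2) = t / 2 by ring)
      _ = γ.extend (2 * (t / 2)) := γ.extend_trans_of_le_half δ (by linarith [t.2.2])
      _ = γ t := by rw [mul_div_cancel₀ _ two_ne_zero, Path.extend_apply γ t.2]
  have second_half : segmentMap F (1 / 2) 1 = δ.toContinuousMap := by
    ext t
    calc segmentMap F (1 / 2) 1 t = (γ.trans δ).extend ((1 + t) / 2) :=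
          congrArg (γ.trans δ).extend
            (show (1 - (t : ℝ)) * (1 / 2) + t * 1 = (1 + t) / 2 by ring)
      _ = δ.extend (2 * ((1 + t) / 2) - 1) := γ.extend_trans_of_half_le δ (by linarith [t.2.1])
      _ = δ t := by
        rw [mul_div_cancel₀ _ two_ne_zero, add_sub_cancel_left, Path.extend_apply δ t.2]
  have whole : segmentMap F 0 1 = (γ.trans δ).toContinuousMap := by
    ext t
    simp [segmentMap_apply, F]
  rw [← first_half, ← second_half, ← whole, add_comm, arcClass_segmentMap_add]

variable (Y) in
/-- The class of a path modulo boundaries of singular `2`-chains, as a path homomorphism. -/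
def pathClass : PathHom Y (Multiplicative
    (AddCommGrpCat.of (ULift.{u} G) ⟶ (singularChains Y G).opcycles 1)) where
  toFun γ := .ofAdd (arcClass G γ.toContinuousMap)
  map_homotopic h := congrArg _ (arcClass_eq_of_homotopic G h)
  map_trans γ δ := congrArg _ (arcClass_trans G γ δ)

/-! ### The first homology group and path homomorphisms -/

/-- The class of a loop in homology, as a morphism out of the coefficient group. -/
def loopHomology {y : Y} (α : Path y y) :
    AddCommGrpCat.of (ULift.{u} G) ⟶ (singularChains Y G).homology 1 :=
  (singularChains Y G).liftCycles (loopChain α G) 0 (by simp) (loopChain_d α G) ≫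
    (singularChains Y G).homologyπ 1

theorem loopHom_apply {y : Y} (α : Path y y) (g : G) :
    loopHom α G g = (loopHomology G α).hom ⟨g⟩ :=
  rfl

theorem loopHomology_homologyι {y : Y} (α : Path y y) :
    loopHomology G α ≫ (singularChains Y G).homologyι 1 = (pathClass Y G α).toAdd := by
  refine (Category.assoc _ _ _).trans ?_
  rw [HomologicalComplex.homology_π_ι, ← Category.assoc, HomologicalComplex.liftCycles_i]
  rfl

/-- The path traced by a map from the unit interval. -/
def arcPath (γ : C(I, Y)) : Path (γ 0) (γ 1) :=
  ⟨γ, rfl, rfl⟩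

section ChainMaps

variable {G} {A : AddCommGrpCat.{max u v}}

theorem exists_chainsDesc (φ : C(I, Y) → (AddCommGrpCat.of (ULift.{u} G) ⟶ A)) :
    ∃ Ψ : (singularChains Y G).X 1 ⟶ A,
      ∀ γ, SSet.ιChainComplex _ (arcSimplex γ) ≫ Ψ = φ γ := by
  refine ⟨Limits.Cofan.IsColimit.desc (SSet.isColimitChainComplexXCofan _ _ 1)
    fun s => φ (arcSimplex.symm s), fun γ => ?_⟩
  refine (Limits.Cofan.IsColimit.fac (SSet.isColimitChainComplexXCofan _ _ 1) _ _).trans ?_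
  exact congrArg φ (arcSimplex.symm_apply_apply γ)

theorem exists_pointsDesc (φ : Y → (AddCommGrpCat.of (ULift.{u} G) ⟶ A)) :
    ∃ Ψ : (singularChains Y G).X 0 ⟶ A,
      ∀ y, SSet.ιChainComplex _ (pointSimplex y) ≫ Ψ = φ y := by
  refine ⟨Limits.Cofan.IsColimit.desc (SSet.isColimitChainComplexXCofan _ _ 0)
    fun s => φ (pointSimplex.symm s), fun y => ?_⟩
  refine (Limits.Cofan.IsColimit.fac (SSet.isColimitChainComplexXCofan _ _ 0) _ _).trans ?_
  exact congrArg φ (pointSimplex.symm_apply_apply y)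

theorem singularChains_hom_ext {f g : (singularChains Y G).X 1 ⟶ A}
    (h : ∀ γ : C(I, Y), SSet.ιChainComplex _ (arcSimplex γ) ≫ f =
      SSet.ιChainComplex _ (arcSimplex γ) ≫ g) : f = g := by
  refine SSet.chainComplex_hom_ext fun s => ?_
  obtain ⟨γ, rfl⟩ := arcSimplex.surjective s
  exact h γ

end ChainMaps

/-- An edge of the standard `2`-simplex. -/
def triangleEdge (i : Fin 3) : Path (stdSimplex.vertex (S := ℝ) (i.succAbove 0))
    (stdSimplex.vertex (S := ℝ) (i.succAbove 1)) where
  toContinuousMap := arc (faceMap i)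
  source' := (congrArg (faceMap i) (stdSimplexHomeomorphUnitInterval.symm_apply_eq.mpr
    stdSimplexHomeomorphUnitInterval_zero.symm)).trans (stdSimplex.map_vertex _ _)
  target' := (congrArg (faceMap i) (stdSimplexHomeomorphUnitInterval.symm_apply_eq.mpr
    stdSimplexHomeomorphUnitInterval_one.symm)).trans (stdSimplex.map_vertex _ _)

theorem PathHom.arcPath_mul_arcPath {Q : Type*} [Group Q] (F : PathHom Y Q)
    (f : C(stdSimplex ℝ (Fin 3), Y)) :
    F (arcPath (arc (f.comp (faceMap 0)))) * F (arcPath (arc (f.comp (faceMap 2)))) =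
      F (arcPath (arc (f.comp (faceMap 1)))) := by
  have : ContractibleSpace (stdSimplex ℝ (Fin 3)) :=
    (convex_stdSimplex ℝ (Fin 3)).contractibleSpace ⟨_, single_mem_stdSimplex ℝ 0⟩
  let γ₀₁ : Path (stdSimplex.vertex (S := ℝ) (0 : Fin 3)) (stdSimplex.vertex 1) := triangleEdge 2
  let γ₁₂ : Path (stdSimplex.vertex (S := ℝ) (1 : Fin 3)) (stdSimplex.vertex 2) := triangleEdge 0
  let γ₀₂ : Path (stdSimplex.vertex (S := ℝ) (0 : Fin 3)) (stdSimplex.vertex 2) := triangleEdge 1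
  have h := (F.comap f).eq_of_simplyConnectedSpace (γ₀₁.trans γ₁₂) γ₀₂
  rw [PathHom.trans_apply] at h
  rw [F.congr (arcPath (arc (f.comp (faceMap 0)))) (γ₁₂.map f.continuous) fun _ => rfl,
    F.congr (arcPath (arc (f.comp (faceMap 1)))) (γ₀₂.map f.continuous) fun _ => rfl,
    F.congr (arcPath (arc (f.comp (faceMap 2)))) (γ₀₁.map f.continuous) fun _ => rfl]
  exact h

variable {G} in
theorem exists_homologyDesc {A : Type max u v} [AddCommGroup A]
    (F : PathHom Y (Multiplicative (G →+ A))) :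
    ∃ T : H₁ Y G →+ A, ∀ {y : Y} (α : Path y y) (g : G), T (loopHom α G g) = (F α).toAdd g := by
  obtain ⟨Ψ, hΨ⟩ := exists_chainsDesc (A := AddCommGrpCat.of A) fun γ : C(I, Y) =>
    AddCommGrpCat.ofHom ((F (arcPath γ)).toAdd.comp AddEquiv.ulift.toAddMonoidHom)
  have d_comp : (singularChains Y G).d 2 1 ≫ Ψ = 0 := by
    refine SSet.chainComplex_hom_ext fun s => ?_
    obtain ⟨f, rfl⟩ := singularSimplex.surjective s
    have h : (SSet.ιChainComplex _ (singularSimplex f) ≫ (singularChains Y G).d 2 1) ≫ Ψ = 0 := by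
      rw [ι_singularSimplex_d, Preadditive.add_comp, Preadditive.sub_comp, hΨ, hΨ, hΨ,
        ← F.arcPath_mul_arcPath f]
      ext g
      simp
    exact (Category.assoc _ _ _).symm.trans (h.trans Limits.comp_zero.symm)
  let Ψ' := (singularChains Y G).descOpcycles Ψ 2 (by simp) d_comp
  refine ⟨((singularChains Y G).homologyι 1 ≫ Ψ').hom, fun α g => ?_⟩
  have h : loopHomology G α ≫ (singularChains Y G).homologyι 1 ≫ Ψ' =
      AddCommGrpCat.ofHom ((F α).toAdd.comp AddEquiv.ulift.toAddMonoidHom) := by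
    rw [← Category.assoc, loopHomology_homologyι]
    refine (Category.assoc _ _ _).trans ?_
    rw [HomologicalComplex.p_descOpcycles]
    refine (hΨ _).trans ?_
    rw [F.congr (arcPath α.toContinuousMap) α fun _ => rfl]
  exact ConcreteCategory.congr_hom h ⟨g⟩

/- Closing up the arcs with paths from the basepoint changes a chain by a homomorphism that factors
through its boundary, so it does nothing to cycles. -/
theorem exists_chains_hom_homology [PathConnectedSpace Y] (y₀ : Y) :
    ∃ Ψ : (singularChains Y G).X 1 ⟶ (singularChains Y G).homology 1,
      (singularChains Y G).iCycles 1 ≫ Ψ = (singularChains Y G).homologyπ 1 ∧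
      ∀ γ : C(I, Y), ∃ α : Path y₀ y₀,
        SSet.ιChainComplex _ (arcSimplex γ) ≫ Ψ = loopHomology G α := by
  let C (p : Y) : Path y₀ p := PathConnectedSpace.somePath y₀ p
  obtain ⟨Ψ, hΨ⟩ := exists_chainsDesc fun γ : C(I, Y) =>
    loopHomology G (((C (γ 0)).trans (arcPath γ)).trans (C (γ 1)).symm)
  obtain ⟨κ, hκ⟩ := exists_pointsDesc fun p => -(pathClass Y G (C p)).toAdd
  have Ψ_homologyι : Ψ ≫ (singularChains Y G).homologyι 1 =
      (singularChains Y G).pOpcycles 1 + (singularChains Y G).d 1 0 ≫ κ := by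
    refine singularChains_hom_ext fun γ => ?_
    rw [Preadditive.comp_add, ← Category.assoc, hΨ, loopHomology_homologyι,
      ← Category.assoc, ι_arcSimplex_d, Preadditive.sub_comp, hκ, hκ,
      PathHom.trans_apply, PathHom.trans_apply, PathHom.symm_apply, toAdd_mul, toAdd_mul,
      toAdd_inv]
    change _ = (pathClass Y G (arcPath γ)).toAdd + _
    abel
  refine ⟨Ψ, ?_, fun γ => ⟨_, hΨ γ⟩⟩
  rw [← cancel_mono ((singularChains Y G).homologyι 1), Category.assoc, Ψ_homologyι,
    Preadditive.comp_add, ← Category.assoc, HomologicalComplex.iCycles_d, Limits.zero_comp,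
    add_zero, HomologicalComplex.homology_π_ι]

variable {G} in
theorem homology_hom_ext [PathConnectedSpace Y] (y₀ : Y) {A : Type max u v} [AddCommGroup A]
    {T T' : H₁ Y G →+ A}
    (h : ∀ (α : Path y₀ y₀) (g : G), T (loopHom α G g) = T' (loopHom α G g)) : T = T' := by
  obtain ⟨Ψ, iCycles_Ψ, hΨ⟩ := exists_chains_hom_homology G y₀
  let S : (singularChains Y G).homology 1 ⟶ AddCommGrpCat.of A := AddCommGrpCat.ofHom T
  let S' : (singularChains Y G).homology 1 ⟶ AddCommGrpCat.of A := AddCommGrpCat.ofHom T'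
  have eq_on_chains : Ψ ≫ S = Ψ ≫ S' := by
    refine singularChains_hom_ext fun γ => ?_
    obtain ⟨α, hα⟩ := hΨ γ
    rw [← Category.assoc, ← Category.assoc, hα]
    ext g
    exact h α g.down
  have eq_on_homology : S = S' := by
    rw [← cancel_epi ((singularChains Y G).homologyπ 1), ← iCycles_Ψ, Category.assoc,
      Category.assoc, eq_on_chains]
  exact congrArg AddCommGrpCat.Hom.hom eq_on_homology

theorem H₁map_loopHom {Z : Type u} [TopologicalSpace Z] (f : C(Y, Z)) {y : Y} (α : Path y y)
    (g : G) : H₁map f G (loopHom α G g) = loopHom (α.map f.continuous) G g := by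
  let φ := SSet.chainComplexMap (TopCat.toSSet.map (TopCat.ofHom f))
    (AddCommGrpCat.of (ULift.{u} G))
  have map_loopChain : loopChain α G ≫ φ.f 1 = loopChain (α.map f.continuous) G :=
    SSet.ι_chainComplexMap_f (TopCat.toSSet.obj (TopCat.of Y)) _ _ _ (loopSimplex α)
  have h : loopHomology G α ≫ HomologicalComplex.homologyMap φ 1 =
      loopHomology G (α.map f.continuous) := by
    refine (Category.assoc _ _ _).trans ?_
    rw [HomologicalComplex.homologyπ_naturality, ← Category.assoc,
      HomologicalComplex.liftCycles_comp_cyclesMap]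
    simp only [loopHomology, map_loopChain]
  exact ConcreteCategory.congr_hom h ⟨g⟩

/-! ### The Hurewicz homomorphism with coefficients -/

theorem loopHom_eq_of_pathClass_eq {x y : Y} {α : Path x x} {β : Path y y}
    (h : pathClass Y G α = pathClass Y G β) : loopHom α G = loopHom β G := by
  have h_homology : loopHomology G α = loopHomology G β := by
    rw [← cancel_mono ((singularChains Y G).homologyι 1), loopHomology_homologyι,
      loopHomology_homologyι, h]
  ext g
  rw [loopHom_apply, loopHom_apply, h_homology]

theorem loopHom_trans {y : Y} (α β : Path y y) :
    loopHom (α.trans β) G = loopHom β G + loopHom α G := by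
  have h_homology : loopHomology G (α.trans β) = loopHomology G β + loopHomology G α := by
    rw [← cancel_mono ((singularChains Y G).homologyι 1), Preadditive.add_comp,
      loopHomology_homologyι, loopHomology_homologyι, loopHomology_homologyι,
      PathHom.trans_apply, toAdd_mul]
  ext g
  rw [loopHom_apply, h_homology]
  rfl

theorem loopHom_conj {x y : Y} (γ : Path x y) (α : Path y y) :
    loopHom ((γ.trans α).trans γ.symm) G = loopHom α G :=
  loopHom_eq_of_pathClass_eq G <| by
    rw [PathHom.trans_apply, PathHom.trans_apply, PathHom.symm_apply, ← mul_assoc,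
      inv_mul_cancel_comm]

/-- The Hurewicz homomorphism `π₁(Y, y) → Hom(G, H₁(Y; G))`, sending the class of a loop `α` to
`g ↦ g • [α]`. -/
def hurewicz (y : Y) : FundamentalGroup Y y →* Multiplicative (G →+ H₁ Y G) :=
  MonoidHom.mk' (fun c => Quotient.lift (s := Path.Homotopic.setoid y y)
    (fun γ : Path y y => Multiplicative.ofAdd (loopHom γ G))
    (fun _ _ h => congrArg _ (loopHom_eq_of_pathClass_eq G ((pathClass Y G).map_homotopic h))) c)
    fun a b => by
      obtain ⟨α, rfl⟩ := Path.Homotopic.Quotient.mk_surjective a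
      obtain ⟨β, rfl⟩ := Path.Homotopic.Quotient.mk_surjective b
      exact congrArg Multiplicative.ofAdd (loopHom_trans G β α)

theorem exists_pathHom_loopHom [PathConnectedSpace Y] :
    ∃ F : PathHom Y (Multiplicative (G →+ H₁ Y G)),
      ∀ {y : Y} (α : Path y y), F α = .ofAdd (loopHom α G) := by
  obtain ⟨y₀⟩ := PathConnectedSpace.nonempty (X := Y)
  let C (p : Y) : Path y₀ p := PathConnectedSpace.somePath y₀ p
  exact ⟨(PathHom.ofBasePaths C).comp (hurewicz G y₀),
    fun α => congrArg Multiplicative.ofAdd (loopHom_conj G (C _) α)⟩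

end SingularChains

/-! ### The isomorphism of homology groups -/

section HomologyEquiv

variable {X : Type u} [MetricSpace X] {G : Type v} [AddCommGroup G]

theorem VanishesOnBalls.spanierH_le_ker {A : Type*} [AddCommGroup A]
    {Φ : PathHom X (Multiplicative (G →+ A))} {R : ℝ} (hΦ : VanishesOnBalls Φ R) {T : H₁ X G →+ A}
    (hT : ∀ {x : X} (α : Path x x) (g : G), T (loopHom α G g) = (Φ α).toAdd g) :
    spanierH X G R ≤ T.ker := by
  refine (AddSubgroup.closure_le _).mpr ?_
  rintro _ ⟨y, w, d, β, g, hd, hβ, rfl⟩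
  refine AddMonoidHom.mem_ker.mpr ?_
  rw [hT, hΦ hd β hβ, toAdd_one, AddMonoidHom.zero_apply]

variable (G) in
theorem exists_pathHom_loopHom_spanierH [PathConnectedSpace X] (R : ℝ) :
    ∃ U : PathHom X (Multiplicative (G →+ H₁ X G ⧸ spanierH X G R)), VanishesOnBalls U R ∧
      ∀ {x : X} (α : Path x x) (g : G), (U α).toAdd g = QuotientAddGroup.mk (loopHom α G g) := by
  obtain ⟨F, hF⟩ := exists_pathHom_loopHom (Y := X) G
  let π := QuotientAddGroup.mk' (spanierH X G R)
  have U_loop {x : X} (α : Path x x) :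
      F.comp (AddMonoidHom.toMultiplicative (AddMonoidHom.compHom π)) α =
        .ofAdd (π.comp (loopHom α G)) :=
    congrArg (fun f : Multiplicative (G →+ H₁ X G) => Multiplicative.ofAdd (π.comp f.toAdd)) (hF α)
  refine ⟨_, fun y w d hd β hβ => ?_, fun α g => by rw [U_loop]; rfl⟩
  rw [U_loop]
  refine congrArg Multiplicative.ofAdd (AddMonoidHom.ext fun g => ?_)
  exact (QuotientAddGroup.eq_zero_iff _).mpr
    (AddSubgroup.subset_closure ⟨y, w, d, β, g, hd, hβ, rfl⟩)

variable (G) in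
theorem exists_addEquiv_homology_rips (hX : IsGeodesicSpace X) (x₀ : X) {r : ℝ} (hr : 0 < r) :
    ∃ e : (H₁ X G ⧸ spanierH X G (3 * r / 2)) ≃+ H₁ (Rips X r hr) G,
      ∀ (x : X) (α : Path x x) (s : Sample α r) (g : G),
        e (QuotientAddGroup.mk (loopHom α G g)) = loopHom (s.loop hr) G g := by
  have := hX.pathConnectedSpace x₀
  have := hX.pathConnectedSpace_rips x₀ hr
  obtain ⟨F, F_loop⟩ := exists_pathHom_loopHom (Y := Rips X r hr) G
  obtain ⟨Φ, hΦ⟩ := exists_isSampleHom F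
  obtain ⟨T, hT⟩ := exists_homologyDesc Φ
  obtain ⟨U, hU, U_loop⟩ := exists_pathHom_loopHom_spanierH (X := X) G (3 * r / 2)
  obtain ⟨Ψ, hΨ⟩ := hU.exists_isSampleHom hX hr
  obtain ⟨ψ, hψ⟩ := exists_homologyDesc Ψ
  let φ := QuotientAddGroup.lift _ T ((hΦ.vanishesOnBalls hX).spanierH_le_ker hT)
  have T_loop (x : X) (α : Path x x) (s : Sample α r) (g : G) :
      T (loopHom α G g) = loopHom (s.loop hr) G g := by
    rw [hT, ← hΦ.loop_apply_of_comm s, F_loop, toAdd_ofAdd]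
  have ψ_T : ψ.comp T = QuotientAddGroup.mk' _ := by
    refine homology_hom_ext x₀ fun α g => ?_
    obtain ⟨s, -⟩ := exists_sample α hr
    refine (congrArg ψ (T_loop x₀ α s g)).trans ?_
    rw [hψ, hΨ.loop_apply_of_comm s, U_loop]
    rfl
  have φ_Ψ (γ : Path (Realization.vertex (rips X r hr) x₀) (Realization.vertex _ x₀)) :
      Ψ.comp (AddMonoidHom.toMultiplicative (AddMonoidHom.compHom φ)) γ = F γ := by
    refine (hΨ.comp _).apply_eq_of_loops_eq hX hΦ (fun α => ?_) γ
    refine Multiplicative.toAdd.injective (AddMonoidHom.ext fun g => ?_)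
    rw [← hT]
    exact congrArg φ (U_loop α g)
  refine ⟨φ.toAddEquiv ψ ?_ ?_, T_loop⟩
  · exact QuotientAddGroup.addMonoidHom_ext _ ψ_T
  · refine homology_hom_ext (Realization.vertex _ x₀) fun γ g => ?_
    refine (congrArg φ (hψ γ g)).trans ?_
    refine (congrArg (fun f : Multiplicative (G →+ _) => f.toAdd g) (φ_Ψ γ)).trans ?_
    rw [F_loop]
    rfl

theorem ripsHBonding_loopHom {p q : ℝ} (hp : 0 < p) (hpq : p < q) {x : X} {α : Path x x}
    (s : Sample α p) (g : G) :
    ripsHBonding X G hp hpq (loopHom (s.loop hp) G g) =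
      loopHom ((s.mono hpq).loop (hp.trans hpq)) G g := by
  refine (H₁map_loopHom G _ _ g).trans ?_
  rw [s.map_loop hpq]
  rfl

end HomologyEquiv

end RipsSpanier

end

open RipsSpanier in
theorem mainTheorem5 {X : Type u} [MetricSpace X] (hX : IsGeodesicSpace X) (x₀ : X)
    (G : Type v) [AddCommGroup G] :
    (∃ e : ∀ (r : ℝ) (hr : 0 < r),
        (FundamentalGroup X x₀ ⧸ spanierPi X x₀ (3 * r / 2)) ≃*
          FundamentalGroup (Rips X r hr) (Realization.vertex _ x₀),
      (∀ (r : ℝ) (hr : 0 < r) (α : Path x₀ x₀) (s : Sample α r) (hs : s.t 0 = 0),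
        e r hr (QuotientGroup.mk (loopClass α)) = loopClass (s.basedLoop hs hr)) ∧
      (∀ (p q : ℝ) (hp : 0 < p) (hpq : p < q)
        (c : FundamentalGroup X x₀ ⧸ spanierPi X x₀ (3 * p / 2)),
        ripsPiBonding X x₀ hp hpq (e p hp c) =
          e q (hp.trans hpq) (spanierPiBonding X x₀ (by linarith) c))) ∧
    (∃ e : ∀ (r : ℝ) (hr : 0 < r),
        (H₁ X G ⧸ spanierH X G (3 * r / 2)) ≃+ H₁ (Rips X r hr) G,
      (∀ (r : ℝ) (hr : 0 < r) (x : X) (α : Path x x) (s : Sample α r) (g : G),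
        e r hr (QuotientAddGroup.mk (loopHom α G g)) = loopHom (s.loop hr) G g) ∧
      (∀ (p q : ℝ) (hp : 0 < p) (hpq : p < q)
        (c : H₁ X G ⧸ spanierH X G (3 * p / 2)),
        ripsHBonding X G hp hpq (e p hp c) =
          e q (hp.trans hpq) (spanierHBonding X G (by linarith) c))) := by
  have := hX.pathConnectedSpace x₀
  constructor
  · choose e he using fun (r : ℝ) (hr : 0 < r) => exists_mulEquiv_fundamentalGroup_rips hX x₀ hr
    refine ⟨e, he, fun p q hp hpq c => ?_⟩
    obtain ⟨a, rfl⟩ := QuotientGroup.mk_surjective c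
    obtain ⟨α, rfl⟩ := exists_loopClass_eq a
    obtain ⟨s, hs⟩ := exists_sample α hp
    rw [he p hp α s hs, ripsPiBonding_basedLoop]
    exact (he q (hp.trans hpq) α (s.mono hpq) hs).symm
  · choose e he using fun (r : ℝ) (hr : 0 < r) => exists_addEquiv_homology_rips G hX x₀ hr
    refine ⟨e, he, fun p q hp hpq c => ?_⟩
    obtain ⟨a, rfl⟩ := QuotientAddGroup.mk_surjective c
    have bonding_comp :
        ((ripsHBonding X G hp hpq).comp (e p hp).toAddMonoidHom).comp (QuotientAddGroup.mk' _) =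
          (e q (hp.trans hpq)).toAddMonoidHom.comp (QuotientAddGroup.mk' _) := by
      refine homology_hom_ext x₀ fun α g => ?_
      obtain ⟨s, -⟩ := exists_sample α hp
      refine (congrArg (ripsHBonding X G hp hpq) (he p hp x₀ α s g)).trans ?_
      exact (ripsHBonding_loopHom hp hpq s g).trans (he q _ x₀ α (s.mono hpq) g).symm
    exact DFunLike.congr_fun bonding_comp a
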